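/- Let $(A,\Delta,\varepsilon)$ be a Hopf algebra over $\mathbb{C}$ and let $(E,d)$ be a bicovariant first order differential calculus over $A$. That is, $E$ is an $A$-bimodule, $d\colon A\to E$ is linear with $d(ab)=d(a)b+a\,d(b)$, every element of $E$ is a finite sum $\sum_k a_k\,db_k$, and whenever $\sum_k a_k\,db_k=0$ one has $\sum_k\Delta(a_k)(\mathrm{id}\otimes d)\Delta(b_k)=0$ in $A\otimes E$ and $\sum_k\Delta(a_k)(d\otimes\mathrm{id})\Delta(b_k)=0$ in $E\otimes A$. Then $\sum_k a_k\,db_k\mapsto\sum_k\Delta(a_k)(\mathrm{id}\otimes d)\Delta(b_k)$ and $\sum_k a_k\,db_k\mapsto\sum_k\Delta(a_k)(d\otimes\mathrm{id})\Delta(b_k)$ are well-defined commuting left and right coactions of $A$ on $E$, written $m\mapsto m_{(-1)}\otimes m_{(0)}$ and $m\mapsto m_{(0)}\otimes m_{(1)}$. On $E\otimes_A E$ one has the left coaction $m\otimes n\mapsto m_{(-1)}n_{(-1)}\otimes(m_{(0)}\otimes n_{(0)})$, the right coaction $m\otimes n\mapsto (m_{(0)}\otimes n_{(0)})\otimes m_{(1)}n_{(1)}$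 and the right action $(m\otimes n)a=m\otimes na$. A (right) connection on $(E,d)$ is a $\mathbb{C}$-linear map $\nabla\colon E\to E\otimes_A E$ with $\nabla(ea)=\nabla(e)a+e\otimes da$ for all $e\in E$, $a\in A$; it is bicovariant if it is a morphism of left comodules and of right comodules. Let $\Omega$ be a normalized dual $2$-cocycle on $A$, that is, a functional $\gamma\colon A\otimes A\to\mathbb{C}$ that is invertible for the convolution product, with inverse $\bar\gamma$, and satisfies $\gamma(1\otimes a)=\varepsilon(a)=\gamma(a\otimes 1)$ and $$\gamma(a_{(1)}\otimes b_{(1)})\,\gamma(a_{(2)}b_{(2)}\otimes c)=\gamma(b_{(1)}\otimes c_{(1)})\,\gamma(a\otimes b_{(2)}c_{(2)})\qquad(a,b,c\in A).$$ Let $A_\Omega$ be the coalgebra $A$ with the product $a*b=\gamma(a_{(1)}\otimes b_{(1)})\,a_{(2)}b_{(2)}\,\bar\gamma(a_{(3)}\otimes b_{(3)})$, let $E_\Omega$ be the vector space $E$ with the actions $$a*m=\gamma(a_{(1)}\otimes m_{(-1)})\,a_{(2)}m_{(0)}\,\bar\gamma(a_{(3)}\otimes m_{(1)}),\qquad m*a=\gamma(m_{(-1)}\otimes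 a_{(1)})\,m_{(0)}a_{(2)}\,\bar\gamma(m_{(1)}\otimes a_{(3)})$$ of $A_\Omega$, and let $d_\Omega=d$; then $(E_\Omega,d_\Omega)$ is a bicovariant first order differential calculus over $A_\Omega$. Let $\xi\colon E_\Omega\otimes_{A_\Omega}E_\Omega\to E\otimes_A E$ be the linear isomorphism $$\xi(m\otimes n)=\gamma(m_{(-1)}\otimes n_{(-1)})\,m_{(0)}\otimes n_{(0)}\,\bar\gamma(m_{(1)}\otimes n_{(1)}).$$ Then for every bicovariant connection $\nabla$ on $(E,d)$ the map $\nabla_\Omega:=\xi^{-1}\circ\nabla\colon E_\Omega\to E_\Omega\otimes_{A_\Omega}E_\Omega$ is a bicovariant connection on $(E_\Omega,d_\Omega)$. Moreover, $\nabla\mapsto\nabla_\Omega$ is a bijection from the set of bicovariant connections on $(E,d)$ onto the set of bicovariant connections on $(E_\Omega,d_\Omega)$. -/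

import Mathlib

open scoped TensorProduct
open Coalgebra WithConv

noncomputable section

/-- A bicomodule over a complex coalgebra `C`: commuting left and right coactions. -/
structure Bicomod (C X : Type*) [AddCommMonoid C] [Module ℂ C] [Coalgebra ℂ C]
    [AddCommMonoid X] [Module ℂ X] where
  lco : X →ₗ[ℂ] C ⊗[ℂ] X
  rco : X →ₗ[ℂ] X ⊗[ℂ] C
  lco_coassoc : ∀ x, TensorProduct.assoc ℂ C C X (comul.rTensor X (lco x)) =
    lco.lTensor C (lco x)
  lco_counit : ∀ x, TensorProduct.lid ℂ X (counit.rTensor X (lco x)) = x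
  rco_coassoc : ∀ x, TensorProduct.assoc ℂ X C C (rco.rTensor C (rco x)) =
    comul.lTensor X (rco x)
  rco_counit : ∀ x, TensorProduct.rid ℂ X (counit.lTensor X (rco x)) = x
  co_comm : ∀ x, TensorProduct.assoc ℂ C X C (lco.rTensor C (rco x)) = rco.lTensor C (lco x)

namespace Bicomod

section Basic

variable {C D X Y : Type*} [AddCommMonoid C] [Module ℂ C] [Coalgebra ℂ C]
  [AddCommMonoid D] [Module ℂ D] [Coalgebra ℂ D]
  [AddCommMonoid X] [Module ℂ X] [AddCommMonoid Y] [Module ℂ Y]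

/-- A coalgebra as a bicomodule over itself. -/
def self (C : Type*) [AddCommMonoid C] [Module ℂ C] [Coalgebra ℂ C] : Bicomod C C where
  lco := comul
  rco := comul
  lco_coassoc x := coassoc_apply x
  lco_counit x := by simp
  rco_coassoc x := coassoc_apply x
  rco_counit x := by simp
  co_comm x := coassoc_apply x

/-- `x ↦ f(x₍₋₁₎) x₍₀₎`. -/
def actL (M : Bicomod C X) (f : C →ₗ[ℂ] ℂ) : X →ₗ[ℂ] X :=
  (TensorProduct.lid ℂ X).toLinearMap ∘ₗ f.rTensor X ∘ₗ M.lco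

/-- `x ↦ x₍₀₎ f(x₍₁₎)`. -/
def actR (M : Bicomod C X) (f : C →ₗ[ℂ] ℂ) : X →ₗ[ℂ] X :=
  (TensorProduct.rid ℂ X).toLinearMap ∘ₗ f.lTensor X ∘ₗ M.rco

/-- `x ↦ u(x₍₋₁₎) x₍₀₎ u⁻¹(x₍₁₎)` for a convolution-invertible functional `u`. -/
def conj (M : Bicomod C X) (u : (WithConv (C →ₗ[ℂ] ℂ))ˣ) : X →ₗ[ℂ] X :=
  M.actL u.val.ofConv ∘ₗ M.actR u⁻¹.val.ofConv

theorem actL_actL (M : Bicomod C X) (f g : WithConv (C →ₗ[ℂ] ℂ)) (x : X) :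
    M.actL f.ofConv (M.actL g.ofConv x) = M.actL (g * f).ofConv x := by
  let F : C ⊗[ℂ] (C ⊗[ℂ] X) →ₗ[ℂ] X := (TensorProduct.lid ℂ X).toLinearMap ∘ₗ
    TensorProduct.map g.ofConv ((TensorProduct.lid ℂ X).toLinearMap ∘ₗ f.ofConv.rTensor X)
  convert congr(F $(M.lco_coassoc x)).symm using 1
  · simp only [actL, LinearMap.comp_apply, LinearEquiv.coe_coe, F]
    hopf_tensor_induction M.lco x with c x'
    simp
  · simp only [actL, LinearMap.comp_apply, LinearEquiv.coe_coe, F]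
    hopf_tensor_induction M.lco x with c x'
    simp only [LinearMap.rTensor_tmul, TensorProduct.lid_tmul, LinearMap.convMul_def,
      LinearMap.comp_apply, ofConv_toConv]
    induction comul (R := ℂ) c with
    | zero => simp
    | tmul c₁ c₂ => simp [smul_smul, mul_comm]
    | add y z hy hz => simp only [map_add, add_smul, TensorProduct.add_tmul, hy, hz]

theorem actR_actR (M : Bicomod C X) (f g : WithConv (C →ₗ[ℂ] ℂ)) (x : X) :
    M.actR f.ofConv (M.actR g.ofConv x) = M.actR (f * g).ofConv x := by
  let F : X ⊗[ℂ] (C ⊗[ℂ] C) →ₗ[ℂ] X := (TensorProduct.rid ℂ X).toLinearMap ∘ₗ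
    TensorProduct.map LinearMap.id (LinearMap.mul' ℂ ℂ ∘ₗ TensorProduct.map f.ofConv g.ofConv)
  convert congr(F $(M.rco_coassoc x)) using 1
  · simp only [actR, LinearMap.comp_apply, LinearEquiv.coe_coe, F]
    hopf_tensor_induction M.rco x with x' c
    simp only [LinearMap.rTensor_tmul, LinearMap.lTensor_tmul, TensorProduct.rid_tmul,
      map_smul]
    induction M.rco x' with
    | zero => simp
    | tmul x₁ c₁ => simp [smul_smul, mul_comm]
    | add y z hy hz => simp only [map_add, smul_add, TensorProduct.add_tmul, hy, hz]
  · simp only [actR, LinearMap.comp_apply, LinearEquiv.coe_coe, F]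
    hopf_tensor_induction M.rco x with x' c
    simp [LinearMap.convMul_def]

theorem actL_actR (M : Bicomod C X) (f g : C →ₗ[ℂ] ℂ) (x : X) :
    M.actL f (M.actR g x) = M.actR g (M.actL f x) := by
  let F : C ⊗[ℂ] (X ⊗[ℂ] C) →ₗ[ℂ] X := (TensorProduct.lid ℂ X).toLinearMap ∘ₗ
    TensorProduct.map f ((TensorProduct.rid ℂ X).toLinearMap ∘ₗ g.lTensor X)
  convert congr(F $(M.co_comm x)) using 1
  · simp only [actL, actR, LinearMap.comp_apply, LinearEquiv.coe_coe, F]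
    hopf_tensor_induction M.rco x with x' c
    simp only [LinearMap.rTensor_tmul, LinearMap.lTensor_tmul, TensorProduct.rid_tmul,
      map_smul]
    induction M.lco x' with
    | zero => simp
    | tmul x₁ c₁ => simp [smul_smul, mul_comm]
    | add y z hy hz => simp only [map_add, smul_add, TensorProduct.add_tmul, hy, hz]
  · simp only [actL, actR, LinearMap.comp_apply, LinearEquiv.coe_coe, F]
    hopf_tensor_induction M.lco x with c x'
    simp

theorem actL_one (M : Bicomod C X) (x : X) : M.actL (1 : WithConv (C →ₗ[ℂ] ℂ)).ofConv x = x :=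
  M.lco_counit x

theorem actR_one (M : Bicomod C X) (x : X) : M.actR (1 : WithConv (C →ₗ[ℂ] ℂ)).ofConv x = x :=
  M.rco_counit x

theorem conj_conj (M : Bicomod C X) (u v : (WithConv (C →ₗ[ℂ] ℂ))ˣ) (x : X) :
    M.conj u (M.conj v x) = M.conj (v * u) x := by
  simp only [conj, LinearMap.comp_apply]
  rw [← actL_actR, actL_actL, actR_actR]
  simp

theorem conj_one (M : Bicomod C X) (x : X) : M.conj 1 x = x := by
  simp only [conj, LinearMap.comp_apply, inv_one, Units.val_one, actL_one, actR_one]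

/-- The linear automorphism `conj u`, with inverse `conj u⁻¹`. -/
def conjEquiv (M : Bicomod C X) (u : (WithConv (C →ₗ[ℂ] ℂ))ˣ) : X ≃ₗ[ℂ] X :=
  LinearEquiv.ofLinearMap (M.conj u) (M.conj u⁻¹)
    (by ext x; simp [conj_conj, conj_one]) (by ext x; simp [conj_conj, conj_one])

/-- `h` is a map of bicomodules along the linear map `p` of coalgebras. -/
structure IsHom (M : Bicomod C X) (N : Bicomod D Y) (p : C →ₗ[ℂ] D) (h : X →ₗ[ℂ] Y) : Prop where
  lco : ∀ x, N.lco (h x) = TensorProduct.map p h (M.lco x)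
  rco : ∀ x, N.rco (h x) = TensorProduct.map h p (M.rco x)

theorem IsHom.actL {M : Bicomod C X} {N : Bicomod D Y} {p : C →ₗ[ℂ] D} {h : X →ₗ[ℂ] Y}
    (H : IsHom M N p h) (f : D →ₗ[ℂ] ℂ) (x : X) : N.actL f (h x) = h (M.actL (f ∘ₗ p) x) := by
  simp only [Bicomod.actL, LinearMap.comp_apply, LinearEquiv.coe_coe, H.lco]
  hopf_tensor_induction M.lco x with c x'
  simp

theorem IsHom.actR {M : Bicomod C X} {N : Bicomod D Y} {p : C →ₗ[ℂ] D} {h : X →ₗ[ℂ] Y}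
    (H : IsHom M N p h) (f : D →ₗ[ℂ] ℂ) (x : X) : N.actR f (h x) = h (M.actR (f ∘ₗ p) x) := by
  simp only [Bicomod.actR, LinearMap.comp_apply, LinearEquiv.coe_coe, H.rco]
  hopf_tensor_induction M.rco x with x' c
  simp

/-- Precomposition of functionals with a coalgebra map. -/
def pull (p : C →ₗc[ℂ] D) : WithConv (D →ₗ[ℂ] ℂ) →* WithConv (C →ₗ[ℂ] ℂ) where
  toFun f := toConv (f.ofConv ∘ₗ p.toLinearMap)
  map_one' := by ext x; simp
  map_mul' f g := by rw [LinearMap.convMul_comp_coalgHom_distrib]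

theorem IsHom.conj {M : Bicomod C X} {N : Bicomod D Y} {p : C →ₗc[ℂ] D} {h : X →ₗ[ℂ] Y}
    (H : IsHom M N p.toLinearMap h) (u : (WithConv (D →ₗ[ℂ] ℂ))ˣ) (x : X) :
    N.conj u (h x) = h (M.conj (Units.map (pull p) u) x) := by
  simp only [Bicomod.conj, LinearMap.comp_apply, H.actL, H.actR]
  rfl

theorem lco_actL (M : Bicomod C X) (f : C →ₗ[ℂ] ℂ) (x : X) :
    M.lco (M.actL f x) = TensorProduct.map ((self C).actL f) LinearMap.id (M.lco x) := by
  let F : C ⊗[ℂ] (C ⊗[ℂ] X) →ₗ[ℂ] C ⊗[ℂ] X := (TensorProduct.lid ℂ _).toLinearMap ∘ₗ LinearMap.rTensor _ f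
  convert congr(F $(M.lco_coassoc x)).symm using 1
  · simp only [actL, LinearMap.comp_apply, LinearEquiv.coe_coe, F]
    hopf_tensor_induction M.lco x with c x'
    simp
  · simp only [actL, LinearMap.comp_apply, LinearEquiv.coe_coe, F, self]
    hopf_tensor_induction M.lco x with c x'
    simp only [LinearMap.rTensor_tmul, TensorProduct.map_tmul, LinearMap.comp_apply,
      LinearMap.id_apply, LinearEquiv.coe_coe]
    hopf_tensor_induction comul (R := ℂ) c with c₁ c₂
    simp [TensorProduct.smul_tmul']

theorem rco_actR (M : Bicomod C X) (f : C →ₗ[ℂ] ℂ) (x : X) :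
    M.rco (M.actR f x) = TensorProduct.map LinearMap.id ((self C).actR f) (M.rco x) := by
  let F : X ⊗[ℂ] (C ⊗[ℂ] C) →ₗ[ℂ] X ⊗[ℂ] C := ((TensorProduct.rid ℂ C).toLinearMap ∘ₗ f.lTensor C).lTensor X
  convert congr(F $(M.rco_coassoc x)) using 1
  · simp only [actR, LinearMap.comp_apply, LinearEquiv.coe_coe, F]
    hopf_tensor_induction M.rco x with x' c
    simp only [LinearMap.rTensor_tmul, LinearMap.lTensor_tmul, TensorProduct.rid_tmul,
      map_smul]
    induction M.rco x' with
    | zero => simp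
    | tmul x₁ c₁ => simp
    | add y z hy hz => simp only [map_add, smul_add, TensorProduct.add_tmul, hy, hz]
  · simp only [actR, LinearMap.comp_apply, LinearEquiv.coe_coe, F, self]
    hopf_tensor_induction M.rco x with x' c
    simp

theorem lco_actR (M : Bicomod C X) (f : C →ₗ[ℂ] ℂ) (x : X) :
    M.lco (M.actR f x) = TensorProduct.map LinearMap.id (M.actR f) (M.lco x) := by
  let F : C ⊗[ℂ] (X ⊗[ℂ] C) →ₗ[ℂ] C ⊗[ℂ] X := ((TensorProduct.rid ℂ X).toLinearMap ∘ₗ f.lTensor X).lTensor C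
  convert congr(F $(M.co_comm x)) using 1
  · simp only [actR, LinearMap.comp_apply, LinearEquiv.coe_coe, F]
    hopf_tensor_induction M.rco x with x' c
    simp only [LinearMap.rTensor_tmul, LinearMap.lTensor_tmul, TensorProduct.rid_tmul,
      map_smul]
    induction M.lco x' with
    | zero => simp
    | tmul x₁ c₁ => simp
    | add y z hy hz => simp only [map_add, smul_add, TensorProduct.add_tmul, hy, hz]
  · simp only [actR, LinearMap.comp_apply, LinearEquiv.coe_coe, F]
    hopf_tensor_induction M.lco x with x' c
    simp

theorem rco_actL (M : Bicomod C X) (f : C →ₗ[ℂ] ℂ) (x : X) :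
    M.rco (M.actL f x) = TensorProduct.map (M.actL f) LinearMap.id (M.rco x) := by
  let F : C ⊗[ℂ] (X ⊗[ℂ] C) →ₗ[ℂ] X ⊗[ℂ] C := (TensorProduct.lid ℂ _).toLinearMap ∘ₗ LinearMap.rTensor _ f
  convert congr(F $(M.co_comm x)).symm using 1
  · simp only [actL, LinearMap.comp_apply, LinearEquiv.coe_coe, F]
    hopf_tensor_induction M.lco x with c x'
    simp
  · simp only [actL, LinearMap.comp_apply, LinearEquiv.coe_coe, F]
    hopf_tensor_induction M.rco x with x' c
    simp only [LinearMap.rTensor_tmul, TensorProduct.map_tmul, LinearMap.comp_apply,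
      LinearMap.id_apply, LinearEquiv.coe_coe]
    hopf_tensor_induction M.lco x' with c₁ c₂
    simp [TensorProduct.smul_tmul']

/-- moving a functional across the middle leg of a coaction -/
theorem lco_middle (M : Bicomod C X) (f : C →ₗ[ℂ] ℂ) (x : X) :
    TensorProduct.map LinearMap.id (M.actL f) (M.lco x) =
      TensorProduct.map ((self C).actR f) LinearMap.id (M.lco x) := by
  let F : C ⊗[ℂ] (C ⊗[ℂ] X) →ₗ[ℂ] C ⊗[ℂ] X := ((TensorProduct.lid ℂ X).toLinearMap ∘ₗ f.rTensor X).lTensor C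
  convert congr(F $(M.lco_coassoc x)).symm using 1
  · simp only [actL, LinearMap.comp_apply, LinearEquiv.coe_coe, F]
    hopf_tensor_induction M.lco x with c x'
    simp
  · simp only [actR, LinearMap.comp_apply, LinearEquiv.coe_coe, F, self]
    hopf_tensor_induction M.lco x with c x'
    simp only [LinearMap.rTensor_tmul, TensorProduct.map_tmul, LinearMap.comp_apply,
      LinearMap.id_apply, LinearEquiv.coe_coe]
    hopf_tensor_induction comul (R := ℂ) c with c₁ c₂
    simp [TensorProduct.smul_tmul]

theorem rco_middle (M : Bicomod C X) (f : C →ₗ[ℂ] ℂ) (x : X) :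
    TensorProduct.map (M.actR f) LinearMap.id (M.rco x) =
      TensorProduct.map LinearMap.id ((self C).actL f) (M.rco x) := by
  let F : X ⊗[ℂ] (C ⊗[ℂ] C) →ₗ[ℂ] X ⊗[ℂ] C := ((TensorProduct.lid ℂ C).toLinearMap ∘ₗ f.rTensor C).lTensor X
  convert congr(F $(M.rco_coassoc x)) using 1
  · simp only [actR, LinearMap.comp_apply, LinearEquiv.coe_coe, F]
    hopf_tensor_induction M.rco x with x' c
    simp only [LinearMap.rTensor_tmul, TensorProduct.map_tmul, LinearMap.comp_apply,
      LinearMap.id_apply, LinearEquiv.coe_coe]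
    hopf_tensor_induction M.rco x' with x₁ c₁
    simp [TensorProduct.smul_tmul]
  · simp only [actL, LinearMap.comp_apply, LinearEquiv.coe_coe, F, self]
    hopf_tensor_induction M.rco x with x' c
    simp

theorem map_map' {P Q R P' Q' R' : Type*} [AddCommMonoid P] [Module ℂ P] [AddCommMonoid Q]
    [Module ℂ Q] [AddCommMonoid R] [Module ℂ R] [AddCommMonoid P'] [Module ℂ P']
    [AddCommMonoid Q'] [Module ℂ Q'] [AddCommMonoid R'] [Module ℂ R']
    (f : Q →ₗ[ℂ] R) (g : Q' →ₗ[ℂ] R') (f' : P →ₗ[ℂ] Q) (g' : P' →ₗ[ℂ] Q') (t : P ⊗[ℂ] P') :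
    TensorProduct.map f g (TensorProduct.map f' g' t) =
      TensorProduct.map (f ∘ₗ f') (g ∘ₗ g') t := by
  rw [TensorProduct.map_comp, LinearMap.comp_apply]

theorem conj_isHom (M : Bicomod C X) (u : (WithConv (C →ₗ[ℂ] ℂ))ˣ) :
    IsHom M M ((self C).conj u) (M.conj u) where
  lco x := by
    have e1 : TensorProduct.map ((self C).conj u) (M.conj u) (M.lco x) =
        TensorProduct.map ((self C).conj u) (M.actR u⁻¹.val.ofConv)
          (TensorProduct.map LinearMap.id (M.actL u.val.ofConv) (M.lco x)) := by
      rw [map_map']; congr 2; ext y; simp [conj, actL_actR]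
    rw [e1, lco_middle, map_map']
    simp only [conj, LinearMap.comp_apply]
    rw [lco_actL, lco_actR, map_map']
    congr 2
    ext c
    simp only [LinearMap.comp_apply, LinearMap.id_apply, actR_actR]
    simp [actR_one]
  rco x := by
    have e1 : TensorProduct.map (M.conj u) ((self C).conj u) (M.rco x) =
        TensorProduct.map (M.actL u.val.ofConv) ((self C).conj u)
          (TensorProduct.map (M.actR u⁻¹.val.ofConv) LinearMap.id (M.rco x)) := by
      rw [map_map']; rfl
    rw [e1, rco_middle, map_map']
    simp only [conj, LinearMap.comp_apply]
    rw [rco_actL, rco_actR, map_map']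
    congr 2
    ext c
    simp only [LinearMap.comp_apply, LinearMap.id_apply, ← actL_actR, actL_actL]
    simp [actL_one]

/-- The tensor product (over `ℂ`) of bicomodules, a bicomodule over the tensor product coalgebra:
`x ⊗ y ↦ (x₍₋₁₎ ⊗ y₍₋₁₎) ⊗ (x₍₀₎ ⊗ y₍₀₎)` and `x ⊗ y ↦ (x₍₀₎ ⊗ y₍₀₎) ⊗ (x₍₁₎ ⊗ y₍₁₎)`. -/
def tensor (M : Bicomod C X) (N : Bicomod D Y) : Bicomod (C ⊗[ℂ] D) (X ⊗[ℂ] Y) where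
  lco := (TensorProduct.tensorTensorTensorComm ℂ C X D Y).toLinearMap ∘ₗ
    TensorProduct.map M.lco N.lco
  rco := (TensorProduct.tensorTensorTensorComm ℂ X C Y D).toLinearMap ∘ₗ
    TensorProduct.map M.rco N.rco
  lco_coassoc t := by
    induction t with
    | zero => simp
    | add s t hs ht => simp only [map_add, hs, ht]
    | tmul x y =>
      let F := ((TensorProduct.tensorTensorTensorComm ℂ C X D Y).toLinearMap.lTensor (C ⊗[ℂ] D)) ∘ₗ
        (TensorProduct.tensorTensorTensorComm ℂ C (C ⊗[ℂ] X) D (D ⊗[ℂ] Y)).toLinearMap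
      convert congr(F ($(M.lco_coassoc x) ⊗ₜ[ℂ] $(N.lco_coassoc y))) using 1
      · simp only [F, LinearMap.comp_apply, LinearEquiv.coe_coe, TensorProduct.map_tmul]
        hopf_tensor_induction M.lco x with x₁ x₂
        hopf_tensor_induction N.lco y with y₁ y₂
        simp only [TensorProduct.tensorTensorTensorComm_tmul, LinearMap.rTensor_tmul,
          TensorProduct.comul_tmul]
        hopf_tensor_induction comul (R := ℂ) x₁ with x₁₁ x₁₂
        hopf_tensor_induction comul (R := ℂ) y₁ with y₁₁ y₁₂
        rfl
      · simp only [F, LinearMap.comp_apply, LinearEquiv.coe_coe, TensorProduct.map_tmul]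
        hopf_tensor_induction M.lco x with x₁ x₂
        hopf_tensor_induction N.lco y with y₁ y₂
        simp
  lco_counit t := by
    induction t with
    | zero => simp
    | add s t hs ht => simp only [map_add, hs, ht]
    | tmul x y =>
      conv_rhs => rw [← M.lco_counit x, ← N.lco_counit y]
      simp only [LinearMap.comp_apply, LinearEquiv.coe_coe, TensorProduct.map_tmul]
      hopf_tensor_induction M.lco x with x₁ x₂
      hopf_tensor_induction N.lco y with y₁ y₂
      simp only [TensorProduct.tensorTensorTensorComm_tmul, LinearMap.rTensor_tmul, LinearMap.lTensor_tmul, LinearMap.comp_apply, LinearEquiv.coe_coe, TensorProduct.map_tmul, TensorProduct.counit_tmul, TensorProduct.lid_tmul, TensorProduct.rid_tmul, TensorProduct.smul_tmul_smul, smul_eq_mul, mul_comm]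
  rco_coassoc t := by
    induction t with
    | zero => simp
    | add s t hs ht => simp only [map_add, hs, ht]
    | tmul x y =>
      let F := ((TensorProduct.tensorTensorTensorComm ℂ C C D D).toLinearMap.lTensor (X ⊗[ℂ] Y)) ∘ₗ
        (TensorProduct.tensorTensorTensorComm ℂ X (C ⊗[ℂ] C) Y (D ⊗[ℂ] D)).toLinearMap
      convert congr(F ($(M.rco_coassoc x) ⊗ₜ[ℂ] $(N.rco_coassoc y))) using 1
      · simp only [F, LinearMap.comp_apply, LinearEquiv.coe_coe, TensorProduct.map_tmul]
        hopf_tensor_induction M.rco x with x₁ x₂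
        hopf_tensor_induction N.rco y with y₁ y₂
        simp only [TensorProduct.tensorTensorTensorComm_tmul, LinearMap.rTensor_tmul,
          LinearMap.comp_apply, LinearEquiv.coe_coe, TensorProduct.map_tmul]
        hopf_tensor_induction M.rco x₁ with x₁₁ x₁₂
        hopf_tensor_induction N.rco y₁ with y₁₁ y₁₂
        rfl
      · simp only [F, LinearMap.comp_apply, LinearEquiv.coe_coe, TensorProduct.map_tmul]
        hopf_tensor_induction M.rco x with x₁ x₂
        hopf_tensor_induction N.rco y with y₁ y₂
        rfl
  rco_counit t := by
    induction t with
    | zero => simp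
    | add s t hs ht => simp only [map_add, hs, ht]
    | tmul x y =>
      conv_rhs => rw [← M.rco_counit x, ← N.rco_counit y]
      simp only [LinearMap.comp_apply, LinearEquiv.coe_coe, TensorProduct.map_tmul]
      hopf_tensor_induction M.rco x with x₁ x₂
      hopf_tensor_induction N.rco y with y₁ y₂
      simp only [TensorProduct.tensorTensorTensorComm_tmul, LinearMap.rTensor_tmul, LinearMap.lTensor_tmul, LinearMap.comp_apply, LinearEquiv.coe_coe, TensorProduct.map_tmul, TensorProduct.counit_tmul, TensorProduct.lid_tmul, TensorProduct.rid_tmul, TensorProduct.smul_tmul_smul, smul_eq_mul, mul_comm]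
  co_comm t := by
    induction t with
    | zero => simp
    | add s t hs ht => simp only [map_add, hs, ht]
    | tmul x y =>
      let F := ((TensorProduct.tensorTensorTensorComm ℂ X C Y D).toLinearMap.lTensor (C ⊗[ℂ] D)) ∘ₗ
        (TensorProduct.tensorTensorTensorComm ℂ C (X ⊗[ℂ] C) D (Y ⊗[ℂ] D)).toLinearMap
      convert congr(F ($(M.co_comm x) ⊗ₜ[ℂ] $(N.co_comm y))) using 1
      · simp only [F, LinearMap.comp_apply, LinearEquiv.coe_coe, TensorProduct.map_tmul]
        hopf_tensor_induction M.rco x with x₁ x₂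
        hopf_tensor_induction N.rco y with y₁ y₂
        simp only [TensorProduct.tensorTensorTensorComm_tmul, LinearMap.rTensor_tmul,
          LinearMap.comp_apply, LinearEquiv.coe_coe, TensorProduct.map_tmul]
        hopf_tensor_induction M.lco x₁ with x₁₁ x₁₂
        hopf_tensor_induction N.lco y₁ with y₁₁ y₁₂
        rfl
      · simp only [F, LinearMap.comp_apply, LinearEquiv.coe_coe, TensorProduct.map_tmul]
        hopf_tensor_induction M.lco x with x₁ x₂
        hopf_tensor_induction N.lco y with y₁ y₂
        simp

theorem tensor_actL (M : Bicomod C X) (N : Bicomod D Y) (f : C →ₗ[ℂ] ℂ) (g : D →ₗ[ℂ] ℂ) :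
    (M.tensor N).actL ((TensorProduct.lid ℂ ℂ).toLinearMap ∘ₗ TensorProduct.map f g) =
      TensorProduct.map (M.actL f) (N.actL g) := by
  ext x y
  simp only [actL, tensor, LinearMap.comp_apply, LinearEquiv.coe_coe, TensorProduct.map_tmul,
    TensorProduct.AlgebraTensorModule.curry_apply, TensorProduct.curry_apply,
    LinearMap.coe_restrictScalars]
  hopf_tensor_induction M.lco x with x₁ x₂
  hopf_tensor_induction N.lco y with y₁ y₂
  simp only [TensorProduct.tensorTensorTensorComm_tmul, LinearMap.rTensor_tmul, LinearMap.lTensor_tmul, LinearMap.comp_apply, LinearEquiv.coe_coe, TensorProduct.map_tmul, TensorProduct.counit_tmul, TensorProduct.lid_tmul, TensorProduct.rid_tmul, TensorProduct.smul_tmul_smul, smul_eq_mul, mul_comm]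

theorem tensor_actR (M : Bicomod C X) (N : Bicomod D Y) (f : C →ₗ[ℂ] ℂ) (g : D →ₗ[ℂ] ℂ) :
    (M.tensor N).actR ((TensorProduct.lid ℂ ℂ).toLinearMap ∘ₗ TensorProduct.map f g) =
      TensorProduct.map (M.actR f) (N.actR g) := by
  ext x y
  simp only [actR, tensor, LinearMap.comp_apply, LinearEquiv.coe_coe, TensorProduct.map_tmul,
    TensorProduct.AlgebraTensorModule.curry_apply, TensorProduct.curry_apply,
    LinearMap.coe_restrictScalars]
  hopf_tensor_induction M.rco x with x₁ x₂
  hopf_tensor_induction N.rco y with y₁ y₂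
  simp only [TensorProduct.tensorTensorTensorComm_tmul, LinearMap.rTensor_tmul, LinearMap.lTensor_tmul, LinearMap.comp_apply, LinearEquiv.coe_coe, TensorProduct.map_tmul, TensorProduct.counit_tmul, TensorProduct.lid_tmul, TensorProduct.rid_tmul, TensorProduct.smul_tmul_smul, smul_eq_mul, mul_comm]

theorem self_tensor (C D : Type*) [AddCommMonoid C] [Module ℂ C] [Coalgebra ℂ C]
    [AddCommMonoid D] [Module ℂ D] [Coalgebra ℂ D] :
    (self C).tensor (self D) = self (C ⊗[ℂ] D) := rfl

theorem IsHom.tensor {C' D' X' Y' : Type*} [AddCommMonoid C'] [Module ℂ C'] [Coalgebra ℂ C']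
    [AddCommMonoid D'] [Module ℂ D'] [Coalgebra ℂ D'] [AddCommMonoid X'] [Module ℂ X']
    [AddCommMonoid Y'] [Module ℂ Y']
    {M : Bicomod C X} {N : Bicomod D Y} {M' : Bicomod C' X'} {N' : Bicomod D' Y'}
    {p : C →ₗ[ℂ] C'} {q : D →ₗ[ℂ] D'} {h : X →ₗ[ℂ] X'} {k : Y →ₗ[ℂ] Y'}
    (H : IsHom M M' p h) (K : IsHom N N' q k) :
    IsHom (M.tensor N) (M'.tensor N') (TensorProduct.map p q) (TensorProduct.map h k) where
  lco t := by
    induction t with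
    | zero => simp
    | add s t hs ht => simp only [map_add, hs, ht]
    | tmul x y =>
      simp only [Bicomod.tensor, LinearMap.comp_apply, LinearEquiv.coe_coe,
        TensorProduct.map_tmul, H.lco, K.lco]
      hopf_tensor_induction M.lco x with x₁ x₂
      hopf_tensor_induction N.lco y with y₁ y₂
      simp
  rco t := by
    induction t with
    | zero => simp
    | add s t hs ht => simp only [map_add, hs, ht]
    | tmul x y =>
      simp only [Bicomod.tensor, LinearMap.comp_apply, LinearEquiv.coe_coe,
        TensorProduct.map_tmul, H.rco, K.rco]
      hopf_tensor_induction M.rco x with x₁ x₂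
      hopf_tensor_induction N.rco y with y₁ y₂
      simp

theorem isHom_id (M : Bicomod C X) : IsHom M M LinearMap.id LinearMap.id where
  lco x := by simp
  rco x := by simp

theorem isHom_assoc {B Z : Type*} [AddCommMonoid B] [Module ℂ B] [Coalgebra ℂ B]
    [AddCommMonoid Z] [Module ℂ Z] (M : Bicomod C X) (N : Bicomod D Y) (P : Bicomod B Z) :
    IsHom ((M.tensor N).tensor P) (M.tensor (N.tensor P))
      (TensorProduct.assoc ℂ C D B).toLinearMap (TensorProduct.assoc ℂ X Y Z).toLinearMap where
  lco t := by
    induction t with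
    | zero => simp
    | add s t hs ht => simp only [map_add, hs, ht]
    | tmul s z =>
      induction s with
      | zero => simp
      | add s t hs ht => simp only [map_add, TensorProduct.add_tmul, hs, ht]
      | tmul x y =>
        simp only [Bicomod.tensor, LinearMap.comp_apply, LinearEquiv.coe_coe,
          TensorProduct.map_tmul, TensorProduct.assoc_tmul]
        hopf_tensor_induction M.lco x with x₁ x₂
        hopf_tensor_induction N.lco y with y₁ y₂
        hopf_tensor_induction P.lco z with z₁ z₂
        simp
  rco t := by
    induction t with
    | zero => simp
    | add s t hs ht => simp only [map_add, hs, ht]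
    | tmul s z =>
      induction s with
      | zero => simp
      | add s t hs ht => simp only [map_add, TensorProduct.add_tmul, hs, ht]
      | tmul x y =>
        simp only [Bicomod.tensor, LinearMap.comp_apply, LinearEquiv.coe_coe,
          TensorProduct.map_tmul, TensorProduct.assoc_tmul]
        hopf_tensor_induction M.rco x with x₁ x₂
        hopf_tensor_induction N.rco y with y₁ y₂
        hopf_tensor_induction P.rco z with z₁ z₂
        simp

theorem IsHom.comp {B Z : Type*} [AddCommMonoid B] [Module ℂ B] [Coalgebra ℂ B]
    [AddCommMonoid Z] [Module ℂ Z] {M : Bicomod C X} {N : Bicomod D Y} {P : Bicomod B Z}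
    {p : C →ₗ[ℂ] D} {q : D →ₗ[ℂ] B} {h : X →ₗ[ℂ] Y} {k : Y →ₗ[ℂ] Z}
    (K : IsHom N P q k) (H : IsHom M N p h) : IsHom M P (q ∘ₗ p) (k ∘ₗ h) where
  lco x := by rw [LinearMap.comp_apply, K.lco, H.lco, map_map']
  rco x := by rw [LinearMap.comp_apply, K.rco, H.rco, map_map']

end Basic

end Bicomod

/-- A bialgebra structure on a complex coalgebra `A`: an associative unital multiplication such that
the comultiplication and the counit are multiplicative and unital.  (Several multiplications on one
coalgebra are considered, so the multiplication is an explicit datum.) -/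
structure BialgStr (A : Type*) [AddCommGroup A] [Module ℂ A] [Coalgebra ℂ A] where
  mul : A ⊗[ℂ] A →ₗ[ℂ] A
  one : A
  mul_assoc : ∀ a b c, mul (mul (a ⊗ₜ b) ⊗ₜ c) = mul (a ⊗ₜ mul (b ⊗ₜ c))
  one_mul : ∀ a, mul (one ⊗ₜ a) = a
  mul_one : ∀ a, mul (a ⊗ₜ one) = a
  comul_mul : ∀ t, comul (R := ℂ) (mul t) = TensorProduct.map mul mul (comul t)
  counit_mul : ∀ t, counit (R := ℂ) (mul t) = counit (R := ℂ) t
  comul_one : comul (R := ℂ) one = one ⊗ₜ one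
  counit_one : counit (R := ℂ) one = 1

namespace BialgStr

/-- The structure of a bialgebra (in particular of a Hopf algebra) `A`. -/
def of (A : Type*) [Ring A] [Bialgebra ℂ A] : BialgStr A where
  mul := LinearMap.mul' ℂ A
  one := 1
  mul_assoc a b c := by simp [_root_.mul_assoc]
  one_mul a := by simp
  mul_one a := by simp
  comul_mul t := (LinearMap.congr_fun (Bialgebra.mulCoalgHom ℂ A).map_comp_comul t).symm
  counit_mul t := LinearMap.congr_fun (Bialgebra.mulCoalgHom ℂ A).counit_comp t
  comul_one := Bialgebra.comul_one
  counit_one := Bialgebra.counit_one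

variable {A : Type*} [AddCommGroup A] [Module ℂ A] [Coalgebra ℂ A]

/-- The multiplication as a coalgebra map. -/
def mulHom (H : BialgStr A) : A ⊗[ℂ] A →ₗc[ℂ] A where
  toLinearMap := H.mul
  counit_comp := LinearMap.ext H.counit_mul
  map_comp_comul := LinearMap.ext fun t => (H.comul_mul t).symm

open Bicomod in
theorem isHom_mul (H : BialgStr A) : IsHom ((self A).tensor (self A)) (self A) H.mul H.mul :=
  ⟨H.comul_mul, H.comul_mul⟩

end BialgStr

/-- A normalized dual 2-cocycle on a bialgebra `A`: an invertible element `Ω` of the convolution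
algebra `(A ⊗ A)*` (the dual algebra of the coalgebra `A ⊗ A`) such that
`(ε̂ ⊗ id)Ω = 1 = (id ⊗ ε̂)Ω` and `(Ω ⊗ 1)(Δ̂ ⊗ id)Ω = (1 ⊗ Ω)(id ⊗ Δ̂)Ω`, where `ε̂` is evaluation
at `1` and `Δ̂` is dual to multiplication.  Writing `γ` for `Ω` as a functional, the last equation is
`γ(a₍₁₎ ⊗ b₍₁₎) γ(a₍₂₎ b₍₂₎ ⊗ c) = γ(b₍₁₎ ⊗ c₍₁₎) γ(a ⊗ b₍₂₎ c₍₂₎)`.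
An invertible element `∑ hᵢ ⊗ kᵢ` of `Â ⊗ Â`, for `Â` the restricted dual of `A`, gives such a
functional by `γ(a ⊗ b) = ∑ hᵢ(a) kᵢ(b)`. -/
structure DualTwoCocycle {A : Type*} [AddCommGroup A] [Module ℂ A] [Coalgebra ℂ A]
    (H : BialgStr A) where
  Ω : (WithConv (A ⊗[ℂ] A →ₗ[ℂ] ℂ))ˣ
  normalized_left : ∀ a : A, Ω.val.ofConv (H.one ⊗ₜ a) = counit a
  normalized_right : ∀ a : A, Ω.val.ofConv (a ⊗ₜ H.one) = counit a
  cocycle :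
    (toConv ((TensorProduct.lid ℂ ℂ).toLinearMap ∘ₗ TensorProduct.map Ω.val.ofConv counit) *
        toConv (Ω.val.ofConv ∘ₗ H.mul.rTensor A) :
      WithConv ((A ⊗[ℂ] A) ⊗[ℂ] A →ₗ[ℂ] ℂ)) =
    toConv ((TensorProduct.lid ℂ ℂ).toLinearMap ∘ₗ TensorProduct.map counit Ω.val.ofConv ∘ₗ
        (TensorProduct.assoc ℂ A A A).toLinearMap) *
      toConv (Ω.val.ofConv ∘ₗ H.mul.lTensor A ∘ₗ
        (TensorProduct.assoc ℂ A A A).toLinearMap)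

namespace DualTwoCocycle

variable {A : Type*} [AddCommGroup A] [Module ℂ A] [Coalgebra ℂ A] {H : BialgStr A}

open Bicomod

/-- `a ↦ a ⊗ 1` -/
def inlHom (H : BialgStr A) : A →ₗc[ℂ] A ⊗[ℂ] A where
  toLinearMap := (TensorProduct.mk ℂ A A).flip H.one
  counit_comp := by ext x; simp [H.counit_one]
  map_comp_comul := by
    ext x
    simp only [LinearMap.comp_apply, LinearMap.flip_apply, TensorProduct.mk_apply,
      TensorProduct.comul_tmul, H.comul_one]
    hopf_tensor_induction comul (R := ℂ) x with x₁ x₂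
    rfl

/-- `a ↦ 1 ⊗ a` -/
def inrHom (H : BialgStr A) : A →ₗc[ℂ] A ⊗[ℂ] A where
  toLinearMap := TensorProduct.mk ℂ A A H.one
  counit_comp := by ext x; simp [H.counit_one]
  map_comp_comul := by
    ext x
    simp only [LinearMap.comp_apply, TensorProduct.mk_apply,
      TensorProduct.comul_tmul, H.comul_one]
    hopf_tensor_induction comul (R := ℂ) x with x₁ x₂
    rfl

/-- `(a ⊗ b) ⊗ c ↦ (a ⊗ b) ε(c)` -/
def fstHom (A : Type*) [AddCommGroup A] [Module ℂ A] [Coalgebra ℂ A] : (A ⊗[ℂ] A) ⊗[ℂ] A →ₗc[ℂ] A ⊗[ℂ] A :=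
  (Coalgebra.TensorProduct.rid ℂ ℂ (A ⊗[ℂ] A)).toCoalgHom.comp
    (Coalgebra.TensorProduct.map (CoalgHom.id ℂ (A ⊗[ℂ] A)) (counitCoalgHom ℂ A))

/-- `a ⊗ (b ⊗ c) ↦ ε(a) (b ⊗ c)` -/
def sndHom (A : Type*) [AddCommGroup A] [Module ℂ A] [Coalgebra ℂ A] : A ⊗[ℂ] (A ⊗[ℂ] A) →ₗc[ℂ] A ⊗[ℂ] A :=
  (Coalgebra.TensorProduct.lid ℂ (A ⊗[ℂ] A)).toCoalgHom.comp
    (Coalgebra.TensorProduct.map (counitCoalgHom ℂ A) (CoalgHom.id ℂ (A ⊗[ℂ] A)))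

/-- `(a ⊗ b) ⊗ c ↦ ab ⊗ c` -/
def mulLHom (H : BialgStr A) : (A ⊗[ℂ] A) ⊗[ℂ] A →ₗc[ℂ] A ⊗[ℂ] A :=
  Coalgebra.TensorProduct.map H.mulHom (CoalgHom.id ℂ A)

/-- `a ⊗ (b ⊗ c) ↦ a ⊗ bc` -/
def mulRHom (H : BialgStr A) : A ⊗[ℂ] (A ⊗[ℂ] A) →ₗc[ℂ] A ⊗[ℂ] A :=
  Coalgebra.TensorProduct.map (CoalgHom.id ℂ A) H.mulHom

/-- The unit `(Ω ⊗ 1)(Δ̂ ⊗ id)Ω` of `(A ⊗ A ⊗ A)*`. -/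
def three (c : DualTwoCocycle H) : (WithConv ((A ⊗[ℂ] A) ⊗[ℂ] A →ₗ[ℂ] ℂ))ˣ :=
  Units.map (pull (fstHom A)) c.Ω * Units.map (pull (mulLHom H)) c.Ω

theorem pull_fst (f : WithConv (A ⊗[ℂ] A →ₗ[ℂ] ℂ)) : pull (fstHom A) f =
    toConv ((TensorProduct.lid ℂ ℂ).toLinearMap ∘ₗ TensorProduct.map f.ofConv counit) := by
  apply WithConv.ofConv_injective
  apply TensorProduct.ext_threefold
  intro x y z
  simp [pull, fstHom, mul_comm]

theorem pull_snd (f : WithConv (A ⊗[ℂ] A →ₗ[ℂ] ℂ)) : pull (sndHom A) f =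
    toConv ((TensorProduct.lid ℂ ℂ).toLinearMap ∘ₗ TensorProduct.map counit f.ofConv) := by
  apply WithConv.ofConv_injective
  ext x y z
  simp [pull, sndHom]

theorem three_eq (c : DualTwoCocycle H) :
    c.three = Units.map (pull (Coalgebra.TensorProduct.assoc ℂ ℂ A A A).toCoalgHom)
      (Units.map (pull (sndHom A)) c.Ω * Units.map (pull (mulRHom H)) c.Ω) := by
  apply Units.ext
  change pull (fstHom A) c.Ω.val * pull (mulLHom H) c.Ω.val =
    pull _ (pull (sndHom A) c.Ω.val * pull (mulRHom H) c.Ω.val)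
  rw [map_mul, pull_fst, pull_snd]
  exact c.cocycle

theorem pull_inl (c : DualTwoCocycle H) : Units.map (pull (inlHom H)) c.Ω = 1 := by
  apply Units.ext
  apply WithConv.ofConv_injective
  ext x
  exact c.normalized_right x

theorem pull_inr (c : DualTwoCocycle H) : Units.map (pull (inrHom H)) c.Ω = 1 := by
  apply Units.ext
  apply WithConv.ofConv_injective
  ext x
  exact c.normalized_left x

section

variable {X Y Z P : Type*} [AddCommMonoid X] [Module ℂ X] [AddCommMonoid Y] [Module ℂ Y]
  [AddCommMonoid Z] [Module ℂ Z] [AddCommMonoid P] [Module ℂ P]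

theorem conj_tmul_one (c : DualTwoCocycle H) (M : Bicomod A X) (x : X) :
    (M.tensor (self A)).conj c.Ω (x ⊗ₜ H.one) = x ⊗ₜ H.one := by
  have H : IsHom M (M.tensor (self A)) (inlHom H).toLinearMap
      ((TensorProduct.mk ℂ X A).flip H.one) := by
    constructor
    · intro x
      simp only [Bicomod.tensor, self, LinearMap.comp_apply, LinearMap.flip_apply,
        TensorProduct.mk_apply, TensorProduct.map_tmul, H.comul_one, LinearEquiv.coe_coe]
      hopf_tensor_induction M.lco x with x₁ x₂
      rfl
    · intro x
      simp only [Bicomod.tensor, self, LinearMap.comp_apply, LinearMap.flip_apply,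
        TensorProduct.mk_apply, TensorProduct.map_tmul, H.comul_one, LinearEquiv.coe_coe]
      hopf_tensor_induction M.rco x with x₁ x₂
      rfl
  have := H.conj c.Ω x
  rw [c.pull_inl, Bicomod.conj_one] at this
  exact this

theorem conj_one_tmul (c : DualTwoCocycle H) (M : Bicomod A X) (x : X) :
    ((self A).tensor M).conj c.Ω (H.one ⊗ₜ x) = H.one ⊗ₜ x := by
  have H : IsHom M ((self A).tensor M) (inrHom H).toLinearMap (TensorProduct.mk ℂ A X H.one) := by
    constructor
    · intro x
      simp only [Bicomod.tensor, self, LinearMap.comp_apply,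
        TensorProduct.mk_apply, TensorProduct.map_tmul, H.comul_one, LinearEquiv.coe_coe]
      hopf_tensor_induction M.lco x with x₁ x₂
      rfl
    · intro x
      simp only [Bicomod.tensor, self, LinearMap.comp_apply,
        TensorProduct.mk_apply, TensorProduct.map_tmul, H.comul_one, LinearEquiv.coe_coe]
      hopf_tensor_induction M.rco x with x₁ x₂
      rfl
  have := H.conj c.Ω x
  rw [c.pull_inr, Bicomod.conj_one] at this
  exact this

theorem map_conj_id (M : Bicomod (A ⊗[ℂ] A) X) (N : Bicomod A Z)
    (u : (WithConv (A ⊗[ℂ] A →ₗ[ℂ] ℂ))ˣ) :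
    TensorProduct.map (M.conj u) LinearMap.id =
      (M.tensor N).conj (Units.map (pull (fstHom A)) u) := by
  rw [Bicomod.conj, Bicomod.conj, ← map_inv, Units.coe_map, Units.coe_map,
    pull_fst, pull_fst, ofConv_toConv, ofConv_toConv, tensor_actL, tensor_actR, ← TensorProduct.map_comp]
  congr 1
  ext z
  exact ((N.actL_one _).trans (N.actR_one z)).symm

theorem map_id_conj (M : Bicomod A X) (N : Bicomod (A ⊗[ℂ] A) Z)
    (u : (WithConv (A ⊗[ℂ] A →ₗ[ℂ] ℂ))ˣ) :
    TensorProduct.map LinearMap.id (N.conj u) =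
      (M.tensor N).conj (Units.map (pull (sndHom A)) u) := by
  rw [Bicomod.conj, Bicomod.conj, ← map_inv, Units.coe_map, Units.coe_map,
    pull_snd, pull_snd, ofConv_toConv, ofConv_toConv, tensor_actL, tensor_actR, ← TensorProduct.map_comp]
  congr 1
  ext z
  exact ((M.actL_one _).trans (M.actR_one z)).symm

/-- The two ways of bracketing a twisted triple product involve the same twist `three`. -/
theorem conj_assoc_left (c : DualTwoCocycle H) {M : Bicomod A X} {N : Bicomod A Y}
    {Q : Bicomod A Z} {R : Bicomod A P} {p : X ⊗[ℂ] Y →ₗ[ℂ] P}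
    (hp : IsHom (M.tensor N) R H.mul p) (t : (X ⊗[ℂ] Y) ⊗[ℂ] Z) :
    (R.tensor Q).conj c.Ω (TensorProduct.map (p ∘ₗ (M.tensor N).conj c.Ω) LinearMap.id t) =
      TensorProduct.map p LinearMap.id (((M.tensor N).tensor Q).conj c.three t) := by
  have H : IsHom ((M.tensor N).tensor Q) (R.tensor Q) (mulLHom H).toLinearMap
      (TensorProduct.map p LinearMap.id) := hp.tensor Q.isHom_id
  have e : TensorProduct.map (p ∘ₗ (M.tensor N).conj c.Ω) LinearMap.id t =
      TensorProduct.map p LinearMap.id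
        (TensorProduct.map ((M.tensor N).conj c.Ω) (LinearMap.id (M := Z)) t) := by
    rw [map_map']; rfl
  rw [e, H.conj, map_conj_id _ Q, conj_conj]
  rfl

theorem conj_assoc_right (c : DualTwoCocycle H) {M : Bicomod A X} {N : Bicomod A Y}
    {Q : Bicomod A Z} {R : Bicomod A P} {p : Y ⊗[ℂ] Z →ₗ[ℂ] P}
    (hp : IsHom (N.tensor Q) R H.mul p) (t : (X ⊗[ℂ] Y) ⊗[ℂ] Z) :
    (M.tensor R).conj c.Ω (TensorProduct.map LinearMap.id (p ∘ₗ (N.tensor Q).conj c.Ω)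
        (TensorProduct.assoc ℂ X Y Z t)) =
      TensorProduct.map LinearMap.id p (TensorProduct.assoc ℂ X Y Z
        (((M.tensor N).tensor Q).conj c.three t)) := by
  have H : IsHom (M.tensor (N.tensor Q)) (M.tensor R) (mulRHom H).toLinearMap
      (TensorProduct.map LinearMap.id p) := M.isHom_id.tensor hp
  have K : IsHom ((M.tensor N).tensor Q) (M.tensor (N.tensor Q))
      (Coalgebra.TensorProduct.assoc ℂ ℂ A A A).toCoalgHom.toLinearMap
      (TensorProduct.assoc ℂ X Y Z).toLinearMap := isHom_assoc M N Q
  have e : TensorProduct.map LinearMap.id (p ∘ₗ (N.tensor Q).conj c.Ω)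
        (TensorProduct.assoc ℂ X Y Z t) =
      TensorProduct.map LinearMap.id p
        (TensorProduct.map (LinearMap.id (M := X)) ((N.tensor Q).conj c.Ω)
          ((TensorProduct.assoc ℂ X Y Z).toLinearMap t)) := by
    rw [map_map']; rfl
  rw [e, H.conj, map_id_conj M _, conj_conj, K.conj, three_eq]
  rfl

/-- An associativity law for maps of bicomodules along the multiplication survives deformation. -/
theorem deformed_assoc (c : DualTwoCocycle H) {P' W : Type*} [AddCommMonoid P'] [Module ℂ P']
    [AddCommMonoid W] [Module ℂ W] {M : Bicomod A X} {N : Bicomod A Y}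
    {Q : Bicomod A Z} {R : Bicomod A P} {R' : Bicomod A P'} {p : X ⊗[ℂ] Y →ₗ[ℂ] P}
    {p' : Y ⊗[ℂ] Z →ₗ[ℂ] P'} (hp : IsHom (M.tensor N) R H.mul p)
    (hp' : IsHom (N.tensor Q) R' H.mul p') (q : P ⊗[ℂ] Z →ₗ[ℂ] W)
    (q' : X ⊗[ℂ] P' →ₗ[ℂ] W) (h : ∀ x y z, q (p (x ⊗ₜ y) ⊗ₜ z) = q' (x ⊗ₜ p' (y ⊗ₜ z)))
    (x : X) (y : Y) (z : Z) :
    q ((R.tensor Q).conj c.Ω (p ((M.tensor N).conj c.Ω (x ⊗ₜ y)) ⊗ₜ z)) =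
      q' ((M.tensor R').conj c.Ω (x ⊗ₜ p' ((N.tensor Q).conj c.Ω (y ⊗ₜ z)))) := by
  have e : q ∘ₗ TensorProduct.map p LinearMap.id = q' ∘ₗ TensorProduct.map LinearMap.id p' ∘ₗ
      (TensorProduct.assoc ℂ X Y Z).toLinearMap := by
    apply TensorProduct.ext_threefold
    exact h
  exact (congrArg q (c.conj_assoc_left (Q := Q) hp ((x ⊗ₜ y) ⊗ₜ z))).trans
    ((LinearMap.congr_fun e _).trans
      (congrArg q' (c.conj_assoc_right (M := M) hp' ((x ⊗ₜ y) ⊗ₜ z))).symm)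

end

theorem counit_conj {C : Type*} [AddCommMonoid C] [Module ℂ C] [Coalgebra ℂ C]
    (u : (WithConv (C →ₗ[ℂ] ℂ))ˣ) (x : C) :
    counit (R := ℂ) ((self C).conj u x) = counit (R := ℂ) x := by
  have h1 : ∀ (f : C →ₗ[ℂ] ℂ) (y : C), counit (R := ℂ) ((self C).actL f y) = f y := by
    intro f y
    conv_rhs => rw [← (self C).rco_counit y]
    simp only [Bicomod.actL, self, LinearMap.comp_apply, LinearEquiv.coe_coe]
    hopf_tensor_induction comul (R := ℂ) y with y₁ y₂
    simp [mul_comm]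
  have h2 : ∀ (f g : WithConv (C →ₗ[ℂ] ℂ)) (y : C),
      f.ofConv ((self C).actR g.ofConv y) = (f * g).ofConv y := by
    intro f g y
    simp only [Bicomod.actR, self, LinearMap.comp_apply, LinearEquiv.coe_coe,
      LinearMap.convMul_def, ofConv_toConv]
    hopf_tensor_induction comul (R := ℂ) y with y₁ y₂
    simp [mul_comm]
  rw [Bicomod.conj, LinearMap.comp_apply, h1, h2]
  simp

/-- The deformed product `a * b = γ(a₍₁₎ ⊗ b₍₁₎) a₍₂₎ b₍₂₎ γ⁻¹(a₍₃₎ ⊗ b₍₃₎)`. -/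
def mulΩ (c : DualTwoCocycle H) : A ⊗[ℂ] A →ₗ[ℂ] A :=
  H.mul ∘ₗ ((self A).tensor (self A)).conj c.Ω

theorem isHom_mulΩ (c : DualTwoCocycle H) :
    IsHom ((self A).tensor (self A)) (self A) c.mulΩ c.mulΩ :=
  H.isHom_mul.comp (((self A).tensor (self A)).conj_isHom c.Ω)

end DualTwoCocycle

/-- The deformed bialgebra `A_Ω`: the vector space, coproduct, counit and unit are those of `A`,
and the product is the deformed one. -/
def BialgStr.deform {A : Type*} [AddCommGroup A] [Module ℂ A] [Coalgebra ℂ A] (H : BialgStr A)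
    (c : DualTwoCocycle H) : BialgStr A where
  mul := c.mulΩ
  one := H.one
  mul_assoc := c.deformed_assoc H.isHom_mul H.isHom_mul H.mul H.mul H.mul_assoc
  one_mul a := (congrArg H.mul (c.conj_one_tmul (Bicomod.self A) a)).trans (H.one_mul a)
  mul_one a := (congrArg H.mul (c.conj_tmul_one (Bicomod.self A) a)).trans (H.mul_one a)
  comul_mul := c.isHom_mulΩ.lco
  counit_mul t := (H.counit_mul _).trans (DualTwoCocycle.counit_conj c.Ω t)
  comul_one := H.comul_one
  counit_one := H.counit_one

/-- A bimodule over a complex algebra, the actions being given as linear maps. -/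
structure AlgBimodule {A : Type*} [AddCommGroup A] [Module ℂ A] [Coalgebra ℂ A]
    (H : BialgStr A) (E : Type*) [AddCommGroup E] [Module ℂ E] where
  lact : A ⊗[ℂ] E →ₗ[ℂ] E
  ract : E ⊗[ℂ] A →ₗ[ℂ] E
  one_lact : ∀ e, lact (H.one ⊗ₜ e) = e
  mul_lact : ∀ a b e, lact (H.mul (a ⊗ₜ b) ⊗ₜ e) = lact (a ⊗ₜ lact (b ⊗ₜ e))
  ract_one : ∀ e, ract (e ⊗ₜ H.one) = e
  ract_mul : ∀ e a b, ract (e ⊗ₜ H.mul (a ⊗ₜ b)) = ract (ract (e ⊗ₜ a) ⊗ₜ b)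
  lact_ract : ∀ a e b, ract (lact (a ⊗ₜ e) ⊗ₜ b) = lact (a ⊗ₜ ract (e ⊗ₜ b))

namespace AlgBimodule

variable {A E : Type*} [AddCommGroup A] [Module ℂ A] [Coalgebra ℂ A] {H : BialgStr A}
  [AddCommGroup E] [Module ℂ E]

/-- `m ⊗ a ⊗ n ↦ ma ⊗ n - m ⊗ an`. -/
def balancing (M : AlgBimodule H E) : (E ⊗[ℂ] A) ⊗[ℂ] E →ₗ[ℂ] E ⊗[ℂ] E :=
  TensorProduct.map M.ract LinearMap.id -
    TensorProduct.map LinearMap.id M.lact ∘ₗ (TensorProduct.assoc ℂ E A E).toLinearMap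

/-- The balanced tensor product `E ⊗_A E`: the quotient of `E ⊗_ℂ E` by the span of all
`ma ⊗ n - m ⊗ an`. -/
abbrev TensorSq (M : AlgBimodule H E) : Type _ := (E ⊗[ℂ] E) ⧸ LinearMap.range M.balancing

/-- The projection `E ⊗_ℂ E → E ⊗_A E`. -/
abbrev proj (M : AlgBimodule H E) : E ⊗[ℂ] E →ₗ[ℂ] M.TensorSq :=
  (LinearMap.range M.balancing).mkQ

theorem proj_balanced (M : AlgBimodule H E) (t : (E ⊗[ℂ] A) ⊗[ℂ] E) :
    M.proj (TensorProduct.map M.ract LinearMap.id t) =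
      M.proj (TensorProduct.map LinearMap.id M.lact (TensorProduct.assoc ℂ E A E t)) := by
  rw [← sub_eq_zero, ← map_sub]
  exact (Submodule.Quotient.mk_eq_zero _).2 ⟨t, rfl⟩

/-- The right action of `a` on `E`. -/
def rmul (M : AlgBimodule H E) (a : A) : E →ₗ[ℂ] E := M.ract ∘ₗ (TensorProduct.mk ℂ E A).flip a

/-- The right action of `a` on `E ⊗_A E`: `(m ⊗ n)a = m ⊗ na`. -/
def rmulSq (M : AlgBimodule H E) (a : A) : M.TensorSq →ₗ[ℂ] M.TensorSq :=
  (LinearMap.range M.balancing).mapQ _ ((M.rmul a).lTensor E) (by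
    rintro _ ⟨t, rfl⟩
    refine ⟨(M.rmul a).lTensor (E ⊗[ℂ] A) t, ?_⟩
    induction t with
    | zero => simp
    | add s t hs ht => simp only [map_add, hs, ht]
    | tmul s z =>
      induction s with
      | zero => simp
      | add s t hs ht => simp only [map_add, TensorProduct.add_tmul, hs, ht]
      | tmul x y => simp [balancing, rmul, M.lact_ract])

end AlgBimodule

/-- A bicovariant bimodule: a bimodule and bicomodule whose left and right coactions satisfy
`Δ(ae) = Δ(a)Δ(e)` and `Δ(ea) = Δ(e)Δ(a)`, that is, the actions `A ⊗ E → E` and `E ⊗ A → E` are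
maps of bicomodules along the multiplication `A ⊗ A → A`. -/
structure BicovariantBimodule {A : Type*} [AddCommGroup A] [Module ℂ A] [Coalgebra ℂ A]
    (H : BialgStr A) (E : Type*) [AddCommGroup E] [Module ℂ E]
    extends AlgBimodule H E, Bicomod A E where
  lact_hom : Bicomod.IsHom ((Bicomod.self A).tensor toBicomod) toBicomod H.mul lact
  ract_hom : Bicomod.IsHom (toBicomod.tensor (Bicomod.self A)) toBicomod H.mul ract

namespace BicovariantBimodule

variable {A E : Type*} [AddCommGroup A] [Module ℂ A] [Coalgebra ℂ A] {H : BialgStr A}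
  [AddCommGroup E] [Module ℂ E]

/-- The left coaction `m ⊗ n ↦ m₍₋₁₎ n₍₋₁₎ ⊗ (m₍₀₎ ⊗ n₍₀₎)` on `E ⊗_A E`. -/
def lcoSq (M : BicovariantBimodule H E) : M.TensorSq →ₗ[ℂ] A ⊗[ℂ] M.TensorSq :=
  (LinearMap.range M.balancing).liftQ
    (TensorProduct.map H.mul M.proj ∘ₗ (M.toBicomod.tensor M.toBicomod).lco) (by
      rintro _ ⟨t, rfl⟩
      have h1 := (M.ract_hom.tensor M.isHom_id).lco t
      have h2 := ((M.isHom_id.tensor M.lact_hom).comp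
        (Bicomod.isHom_assoc M.toBicomod (Bicomod.self A) M.toBicomod)).lco t
      simp only [LinearMap.mem_ker, AlgBimodule.balancing, LinearMap.sub_apply, map_sub,
        sub_eq_zero, LinearMap.comp_apply] at h1 h2 ⊢
      rw [h1, h2, Bicomod.map_map', Bicomod.map_map']
      congr 2
      · ext a b c
        simp [H.mul_assoc]
      · exact LinearMap.ext fun t => M.proj_balanced _)

/-- The right coaction `m ⊗ n ↦ (m₍₀₎ ⊗ n₍₀₎) ⊗ m₍₁₎ n₍₁₎` on `E ⊗_A E`. -/
def rcoSq (M : BicovariantBimodule H E) : M.TensorSq →ₗ[ℂ] M.TensorSq ⊗[ℂ] A :=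
  (LinearMap.range M.balancing).liftQ
    (TensorProduct.map M.proj H.mul ∘ₗ (M.toBicomod.tensor M.toBicomod).rco) (by
      rintro _ ⟨t, rfl⟩
      have h1 := (M.ract_hom.tensor M.isHom_id).rco t
      have h2 := ((M.isHom_id.tensor M.lact_hom).comp
        (Bicomod.isHom_assoc M.toBicomod (Bicomod.self A) M.toBicomod)).rco t
      simp only [LinearMap.mem_ker, AlgBimodule.balancing, LinearMap.sub_apply, map_sub,
        sub_eq_zero, LinearMap.comp_apply] at h1 h2 ⊢
      rw [h1, h2, Bicomod.map_map', Bicomod.map_map']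
      congr 2
      · exact LinearMap.ext fun t => M.proj_balanced _
      · ext a b c
        simp [H.mul_assoc])

/-- The deformed left action `a * m = γ(a₍₁₎ ⊗ m₍₋₁₎) a₍₂₎ m₍₀₎ γ⁻¹(a₍₃₎ ⊗ m₍₁₎)`. -/
def lactΩ (M : BicovariantBimodule H E) (c : DualTwoCocycle H) : A ⊗[ℂ] E →ₗ[ℂ] E :=
  M.lact ∘ₗ ((Bicomod.self A).tensor M.toBicomod).conj c.Ω

/-- The deformed right action `m * a = γ(m₍₋₁₎ ⊗ a₍₁₎) m₍₀₎ a₍₂₎ γ⁻¹(m₍₁₎ ⊗ a₍₃₎)`. -/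
def ractΩ (M : BicovariantBimodule H E) (c : DualTwoCocycle H) : E ⊗[ℂ] A →ₗ[ℂ] E :=
  M.ract ∘ₗ (M.toBicomod.tensor (Bicomod.self A)).conj c.Ω

theorem one_lactΩ (M : BicovariantBimodule H E) (c : DualTwoCocycle H) (e : E) :
    M.lactΩ c (H.one ⊗ₜ e) = e :=
  (congrArg M.lact (c.conj_one_tmul M.toBicomod e)).trans (M.one_lact e)

theorem ractΩ_one (M : BicovariantBimodule H E) (c : DualTwoCocycle H) (e : E) :
    M.ractΩ c (e ⊗ₜ H.one) = e :=
  (congrArg M.ract (c.conj_tmul_one M.toBicomod e)).trans (M.ract_one e)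

theorem mul_lactΩ (M : BicovariantBimodule H E) (c : DualTwoCocycle H) (a b : A) (e : E) :
    M.lactΩ c (c.mulΩ (a ⊗ₜ b) ⊗ₜ e) = M.lactΩ c (a ⊗ₜ M.lactΩ c (b ⊗ₜ e)) :=
  c.deformed_assoc H.isHom_mul M.lact_hom M.lact M.lact
    (fun x y z => M.mul_lact x y z) a b e

theorem ractΩ_mul (M : BicovariantBimodule H E) (c : DualTwoCocycle H) (e : E) (a b : A) :
    M.ractΩ c (e ⊗ₜ c.mulΩ (a ⊗ₜ b)) = M.ractΩ c (M.ractΩ c (e ⊗ₜ a) ⊗ₜ b) :=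
  (c.deformed_assoc M.ract_hom H.isHom_mul M.ract M.ract
    (fun x y z => (M.ract_mul x y z).symm) e a b).symm

theorem lactΩ_ractΩ (M : BicovariantBimodule H E) (c : DualTwoCocycle H) (a : A) (e : E) (b : A) :
    M.ractΩ c (M.lactΩ c (a ⊗ₜ e) ⊗ₜ b) = M.lactΩ c (a ⊗ₜ M.ractΩ c (e ⊗ₜ b)) :=
  c.deformed_assoc M.lact_hom M.ract_hom M.ract M.lact (fun x y z => M.lact_ract x y z) a e b

theorem lactΩ_hom (M : BicovariantBimodule H E) (c : DualTwoCocycle H) :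
    Bicomod.IsHom ((Bicomod.self A).tensor M.toBicomod) M.toBicomod c.mulΩ (M.lactΩ c) :=
  M.lact_hom.comp (((Bicomod.self A).tensor M.toBicomod).conj_isHom c.Ω)

theorem ractΩ_hom (M : BicovariantBimodule H E) (c : DualTwoCocycle H) :
    Bicomod.IsHom (M.toBicomod.tensor (Bicomod.self A)) M.toBicomod c.mulΩ (M.ractΩ c) :=
  M.ract_hom.comp ((M.toBicomod.tensor (Bicomod.self A)).conj_isHom c.Ω)

/-- The deformed bicovariant bimodule `E_Ω` over `A_Ω`: the coactions are those of `E`, and the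
actions are the deformed ones. -/
def deform (M : BicovariantBimodule H E) (c : DualTwoCocycle H) :
    BicovariantBimodule (H.deform c) E where
  toBicomod := M.toBicomod
  lact := M.lactΩ c
  ract := M.ractΩ c
  one_lact := M.one_lactΩ c
  mul_lact := M.mul_lactΩ c
  ract_one := M.ractΩ_one c
  ract_mul := M.ractΩ_mul c
  lact_ract := M.lactΩ_ractΩ c
  lact_hom := by
    exact M.lactΩ_hom c
  ract_hom := by
    exact M.ractΩ_hom c

theorem balancing_deform (M : BicovariantBimodule H E) (c : DualTwoCocycle H) :
    (M.deform c).balancing = TensorProduct.map (M.ractΩ c) LinearMap.id -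
      TensorProduct.map LinearMap.id (M.lactΩ c) ∘ₗ (TensorProduct.assoc ℂ E A E).toLinearMap :=
  rfl

theorem map_range_balancing (M : BicovariantBimodule H E) (c : DualTwoCocycle H) :
    (LinearMap.range (M.deform c).balancing).map
      ((M.toBicomod.tensor M.toBicomod).conjEquiv c.Ω).toLinearMap =
        LinearMap.range M.balancing := by
  have key : ∀ t : (E ⊗[ℂ] A) ⊗[ℂ] E,
      (M.toBicomod.tensor M.toBicomod).conj c.Ω ((TensorProduct.map (M.ractΩ c) LinearMap.id -
        TensorProduct.map LinearMap.id (M.lactΩ c) ∘ₗ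
          (TensorProduct.assoc ℂ E A E).toLinearMap : _ →ₗ[ℂ] E ⊗[ℂ] E) t) =
      M.balancing (((M.toBicomod.tensor (Bicomod.self A)).tensor M.toBicomod).conj c.three t) := by
    intro t
    have h1 := c.conj_assoc_left (Q := M.toBicomod) M.ract_hom t
    have h2 := c.conj_assoc_right (M := M.toBicomod) M.lact_hom t
    rw [LinearMap.sub_apply, map_sub]
    exact congrArg₂ (· - ·) h1 h2
  apply le_antisymm
  · rintro _ ⟨_, ⟨t, rfl⟩, rfl⟩
    exact ⟨_, (key t).symm⟩
  · rintro _ ⟨t, rfl⟩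
    refine ⟨_, ⟨((M.toBicomod.tensor (Bicomod.self A)).tensor M.toBicomod).conj c.three⁻¹ t, rfl⟩,
      (key _).trans ?_⟩
    rw [Bicomod.conj_conj, inv_mul_cancel, Bicomod.conj_one]

/-- The isomorphism `ξ : E_Ω ⊗_{A_Ω} E_Ω → (E ⊗_A E)_Ω` given by
`ξ(m ⊗ n) = γ(m₍₋₁₎ ⊗ n₍₋₁₎) m₍₀₎ ⊗ n₍₀₎ γ⁻¹(m₍₁₎ ⊗ n₍₁₎)`; here `(E ⊗_A E)_Ω` is `E ⊗_A E` as a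
vector space. -/
def xi (M : BicovariantBimodule H E) (c : DualTwoCocycle H) :
    (M.deform c).TensorSq ≃ₗ[ℂ] M.TensorSq :=
  Submodule.Quotient.equiv _ _ ((M.toBicomod.tensor M.toBicomod).conjEquiv c.Ω)
    (M.map_range_balancing c)

end BicovariantBimodule
namespace Bicomod

variable {C D X Y : Type*} [AddCommMonoid C] [Module ℂ C] [Coalgebra ℂ C]
  [AddCommMonoid D] [Module ℂ D] [Coalgebra ℂ D]
  [AddCommMonoid X] [Module ℂ X] [AddCommMonoid Y] [Module ℂ Y]

/-- Coactions that receive a surjective comodule map from a bicomodule form a bicomodule. -/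
def ofSurjective (N : Bicomod D Y) (p : D →ₗc[ℂ] C) (s : Y →ₗ[ℂ] X) (hs : Function.Surjective s)
    (lco : X →ₗ[ℂ] C ⊗[ℂ] X) (rco : X →ₗ[ℂ] X ⊗[ℂ] C)
    (hl : ∀ y, lco (s y) = TensorProduct.map p.toLinearMap s (N.lco y))
    (hr : ∀ y, rco (s y) = TensorProduct.map s p.toLinearMap (N.rco y)) : Bicomod C X where
  lco := lco
  rco := rco
  lco_coassoc x := by
    obtain ⟨y, rfl⟩ := hs x
    have h := congrArg (TensorProduct.map p.toLinearMap (TensorProduct.map p.toLinearMap s))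
      (N.lco_coassoc y)
    rw [hl]
    convert h using 1
    · hopf_tensor_induction N.lco y with d y'
      simp only [TensorProduct.map_tmul, LinearMap.rTensor_tmul]
      have hd := LinearMap.congr_fun p.map_comp_comul d
      simp only [LinearMap.comp_apply] at hd
      rw [← hd]
      hopf_tensor_induction comul (R := ℂ) d with d₁ d₂
      simp
    · hopf_tensor_induction N.lco y with d y'
      simp [hl]
  lco_counit x := by
    obtain ⟨y, rfl⟩ := hs x
    conv_rhs => rw [← N.lco_counit y]
    rw [hl]
    hopf_tensor_induction N.lco y with d y'
    have hd := LinearMap.congr_fun p.counit_comp d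
    simp only [LinearMap.comp_apply] at hd
    simp only [TensorProduct.map_tmul, LinearMap.rTensor_tmul, TensorProduct.lid_tmul, map_smul, hd]
  rco_coassoc x := by
    obtain ⟨y, rfl⟩ := hs x
    have h := congrArg (TensorProduct.map s (TensorProduct.map p.toLinearMap p.toLinearMap))
      (N.rco_coassoc y)
    rw [hr]
    convert h using 1
    · hopf_tensor_induction N.rco y with y' d
      simp only [TensorProduct.map_tmul, LinearMap.rTensor_tmul, hr]
      hopf_tensor_induction N.rco y' with d₁ d₂
      simp
    · hopf_tensor_induction N.rco y with y' d
      have hd := LinearMap.congr_fun p.map_comp_comul d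
      simp only [LinearMap.comp_apply] at hd
      simp only [TensorProduct.map_tmul, LinearMap.lTensor_tmul, hd]
  rco_counit x := by
    obtain ⟨y, rfl⟩ := hs x
    conv_rhs => rw [← N.rco_counit y]
    rw [hr]
    hopf_tensor_induction N.rco y with y' d
    have hd := LinearMap.congr_fun p.counit_comp d
    simp only [LinearMap.comp_apply] at hd
    simp only [TensorProduct.map_tmul, LinearMap.lTensor_tmul, TensorProduct.rid_tmul, map_smul, hd]
  co_comm x := by
    obtain ⟨y, rfl⟩ := hs x
    have h := congrArg (TensorProduct.map p.toLinearMap (TensorProduct.map s p.toLinearMap))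
      (N.co_comm y)
    rw [hl, hr]
    convert h using 1
    · hopf_tensor_induction N.rco y with y' d
      simp only [TensorProduct.map_tmul, LinearMap.rTensor_tmul, hl]
      hopf_tensor_induction N.lco y' with d₁ d₂
      simp
    · hopf_tensor_induction N.lco y with d y'
      simp [hr]

end Bicomod

/-- A bicovariant first order differential calculus `(E, d)` over `A`: a bimodule `E` with a linear
derivation `d : A → E` such that every element of `E` is a finite sum `∑ aₖ d(bₖ)`, and such that
`∑ aₖ d(bₖ) = 0` implies `∑ Δ(aₖ)(id ⊗ d)Δ(bₖ) = 0` in `A ⊗ E` and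
`∑ Δ(aₖ)(d ⊗ id)Δ(bₖ) = 0` in `E ⊗ A`. -/
structure BicovariantCalculus {A : Type*} [AddCommGroup A] [Module ℂ A] [Coalgebra ℂ A]
    (H : BialgStr A) (E : Type*) [AddCommGroup E] [Module ℂ E]
    extends AlgBimodule H E where
  d : A →ₗ[ℂ] E
  leibniz : ∀ a b, d (H.mul (a ⊗ₜ b)) = ract (d a ⊗ₜ b) + lact (a ⊗ₜ d b)
  exists_eq_sum : ∀ ρ : E, ∃ (K : ℕ) (a b : Fin K → A), ρ = ∑ k, lact (a k ⊗ₜ d (b k))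
  left_covariant : ∀ (K : ℕ) (a b : Fin K → A), ∑ k, lact (a k ⊗ₜ d (b k)) = 0 →
    ∑ k, TensorProduct.map H.mul lact
      (TensorProduct.tensorTensorTensorComm ℂ A A A E
        (comul (a k) ⊗ₜ d.lTensor A (comul (b k)))) = 0
  right_covariant : ∀ (K : ℕ) (a b : Fin K → A), ∑ k, lact (a k ⊗ₜ d (b k)) = 0 →
    ∑ k, TensorProduct.map lact H.mul
      (TensorProduct.tensorTensorTensorComm ℂ A A E A
        (comul (a k) ⊗ₜ d.rTensor A (comul (b k)))) = 0

namespace BicovariantCalculus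

variable {A E : Type*} [AddCommGroup A] [Module ℂ A] [Coalgebra ℂ A] {H : BialgStr A}
  [AddCommGroup E] [Module ℂ E]

/-- `a ⊗ b ↦ a d(b)`. -/
def adb (Γ : BicovariantCalculus H E) : A ⊗[ℂ] A →ₗ[ℂ] E := Γ.lact ∘ₗ Γ.d.lTensor A

theorem adb_surjective (Γ : BicovariantCalculus H E) : Function.Surjective Γ.adb := by
  intro ρ
  obtain ⟨K, a, b, rfl⟩ := Γ.exists_eq_sum ρ
  exact ⟨∑ k, a k ⊗ₜ b k, by simp [adb]⟩

/-- `a ⊗ b ↦ Δ(a)(id ⊗ d)Δ(b)`. -/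
def adbL (Γ : BicovariantCalculus H E) : A ⊗[ℂ] A →ₗ[ℂ] A ⊗[ℂ] E :=
  TensorProduct.map H.mul Γ.lact ∘ₗ
    (TensorProduct.tensorTensorTensorComm ℂ A A A E).toLinearMap ∘ₗ
      TensorProduct.map comul (Γ.d.lTensor A ∘ₗ comul)

/-- `a ⊗ b ↦ Δ(a)(d ⊗ id)Δ(b)`. -/
def adbR (Γ : BicovariantCalculus H E) : A ⊗[ℂ] A →ₗ[ℂ] E ⊗[ℂ] A :=
  TensorProduct.map Γ.lact H.mul ∘ₗ
    (TensorProduct.tensorTensorTensorComm ℂ A A E A).toLinearMap ∘ₗ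
      TensorProduct.map comul (Γ.d.rTensor A ∘ₗ comul)

theorem exists_fin_sum {V : Type*} [AddCommGroup V] [Module ℂ V] (t : V ⊗[ℂ] V) :
    ∃ (K : ℕ) (a b : Fin K → V), t = ∑ k, a k ⊗ₜ[ℂ] b k := by
  obtain ⟨S, rfl⟩ := TensorProduct.exists_finset t
  refine ⟨S.card, fun k => (S.equivFin.symm k).1.1, fun k => (S.equivFin.symm k).1.2, ?_⟩
  rw [← Finset.sum_coe_sort S]
  exact (Equiv.sum_comp S.equivFin.symm (fun i : S => i.1.1 ⊗ₜ[ℂ] i.1.2)).symm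

theorem ker_le_left (Γ : BicovariantCalculus H E) : LinearMap.ker Γ.adb ≤ LinearMap.ker Γ.adbL := by
  intro t ht
  obtain ⟨K, a, b, rfl⟩ := exists_fin_sum t
  have := Γ.left_covariant K a b (by simpa [adb] using ht)
  simpa [adbL] using this

theorem ker_le_right (Γ : BicovariantCalculus H E) :
    LinearMap.ker Γ.adb ≤ LinearMap.ker Γ.adbR := by
  intro t ht
  obtain ⟨K, a, b, rfl⟩ := exists_fin_sum t
  have := Γ.right_covariant K a b (by simpa [adb] using ht)
  simpa [adbR] using this

/-- The left coaction on `E`, determined by `∑ aₖ d(bₖ) ↦ ∑ Δ(aₖ)(id ⊗ d)Δ(bₖ)`. -/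
def lco (Γ : BicovariantCalculus H E) : E →ₗ[ℂ] A ⊗[ℂ] E :=
  (LinearMap.ker Γ.adb).liftQ Γ.adbL Γ.ker_le_left ∘ₗ
    (Γ.adb.quotKerEquivOfSurjective Γ.adb_surjective).symm.toLinearMap

/-- The right coaction on `E`, determined by `∑ aₖ d(bₖ) ↦ ∑ Δ(aₖ)(d ⊗ id)Δ(bₖ)`. -/
def rco (Γ : BicovariantCalculus H E) : E →ₗ[ℂ] E ⊗[ℂ] A :=
  (LinearMap.ker Γ.adb).liftQ Γ.adbR Γ.ker_le_right ∘ₗ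
    (Γ.adb.quotKerEquivOfSurjective Γ.adb_surjective).symm.toLinearMap

theorem lco_adb (Γ : BicovariantCalculus H E) (t : A ⊗[ℂ] A) : Γ.lco (Γ.adb t) = Γ.adbL t := by
  have h : (Γ.adb.quotKerEquivOfSurjective Γ.adb_surjective).symm (Γ.adb t) =
      Submodule.Quotient.mk t := by
    rw [LinearEquiv.symm_apply_eq]; rfl
  simp only [lco, LinearMap.comp_apply, LinearEquiv.coe_coe, h]
  rfl

theorem rco_adb (Γ : BicovariantCalculus H E) (t : A ⊗[ℂ] A) : Γ.rco (Γ.adb t) = Γ.adbR t := by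
  have h : (Γ.adb.quotKerEquivOfSurjective Γ.adb_surjective).symm (Γ.adb t) =
      Submodule.Quotient.mk t := by
    rw [LinearEquiv.symm_apply_eq]; rfl
  simp only [rco, LinearMap.comp_apply, LinearEquiv.coe_coe, h]
  rfl

theorem adbL_eq (Γ : BicovariantCalculus H E) (t : A ⊗[ℂ] A) :
    Γ.adbL t = TensorProduct.map H.mul Γ.adb (comul t) := by
  induction t with
  | zero => simp
  | add s t hs ht => simp only [map_add, hs, ht]
  | tmul a b =>
    simp only [adbL, adb, LinearMap.comp_apply, TensorProduct.map_tmul, TensorProduct.comul_tmul,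
      LinearEquiv.coe_coe]
    hopf_tensor_induction comul (R := ℂ) a with a₁ a₂
    hopf_tensor_induction comul (R := ℂ) b with b₁ b₂
    simp

theorem adbR_eq (Γ : BicovariantCalculus H E) (t : A ⊗[ℂ] A) :
    Γ.adbR t = TensorProduct.map Γ.adb H.mul (comul t) := by
  induction t with
  | zero => simp
  | add s t hs ht => simp only [map_add, hs, ht]
  | tmul a b =>
    simp only [adbR, adb, LinearMap.comp_apply, TensorProduct.map_tmul, TensorProduct.comul_tmul,
      LinearEquiv.coe_coe]
    hopf_tensor_induction comul (R := ℂ) a with a₁ a₂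
    hopf_tensor_induction comul (R := ℂ) b with b₁ b₂
    simp

/-- The two coactions make `E` a bicomodule. -/
def bicomod (Γ : BicovariantCalculus H E) : Bicomod A E :=
  Bicomod.ofSurjective (Bicomod.self (A ⊗[ℂ] A)) H.mulHom Γ.adb
    Γ.adb_surjective Γ.lco Γ.rco (fun t => (Γ.lco_adb t).trans (Γ.adbL_eq t))
    (fun t => (Γ.rco_adb t).trans (Γ.adbR_eq t))

theorem isHom_adb (Γ : BicovariantCalculus H E) :
    Bicomod.IsHom ((Bicomod.self A).tensor (Bicomod.self A)) Γ.bicomod H.mul Γ.adb :=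
  ⟨fun t => (Γ.lco_adb t).trans (Γ.adbL_eq t), fun t => (Γ.rco_adb t).trans (Γ.adbR_eq t)⟩

open Bicomod DualTwoCocycle in
theorem lact_hom (Γ : BicovariantCalculus H E) :
    IsHom ((self A).tensor Γ.bicomod) Γ.bicomod H.mul Γ.lact := by
  have hs : Function.Surjective (TensorProduct.map (LinearMap.id (M := A)) Γ.adb) :=
    TensorProduct.map_surjective Function.surjective_id Γ.adb_surjective
  have H₁ := (self A).isHom_id.tensor Γ.isHom_adb
  have K := Γ.isHom_adb.comp (H.isHom_mul.tensor (self A).isHom_id)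
  have e1 : Γ.lact ∘ₗ TensorProduct.map LinearMap.id Γ.adb ∘ₗ
      (TensorProduct.assoc ℂ A A A).toLinearMap =
      Γ.adb ∘ₗ TensorProduct.map H.mul LinearMap.id := by
    apply TensorProduct.ext_threefold
    intro x y z
    simp [adb, Γ.mul_lact]
  have e2 : H.mul ∘ₗ TensorProduct.map LinearMap.id H.mul ∘ₗ
      (TensorProduct.assoc ℂ A A A).toLinearMap =
      H.mul ∘ₗ TensorProduct.map H.mul LinearMap.id := by
    apply TensorProduct.ext_threefold
    intro x y z
    simp [H.mul_assoc]
  have H' := H₁.comp (isHom_assoc (self A) (self A) (self A))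
  have ha := (TensorProduct.assoc ℂ A A A).surjective
  constructor
  · intro x
    obtain ⟨t, rfl⟩ := hs x
    obtain ⟨t, rfl⟩ := ha t
    have h1 := H'.lco t
    have h2 := K.lco t
    have h3 := LinearMap.congr_fun e1 t
    simp only [LinearMap.comp_apply, LinearEquiv.coe_coe] at h1 h2 h3
    rw [h1, h3, h2, map_map', e1, e2]
  · intro x
    obtain ⟨t, rfl⟩ := hs x
    obtain ⟨t, rfl⟩ := ha t
    have h1 := H'.rco t
    have h2 := K.rco t
    have h3 := LinearMap.congr_fun e1 t
    simp only [LinearMap.comp_apply, LinearEquiv.coe_coe] at h1 h2 h3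
    rw [h1, h3, h2, map_map', e1, e2]

theorem map_sub_right' {P Q R S : Type*} [AddCommGroup P] [Module ℂ P] [AddCommGroup Q]
    [Module ℂ Q] [AddCommGroup R] [Module ℂ R] [AddCommGroup S] [Module ℂ S]
    (f : P →ₗ[ℂ] Q) (g h : R →ₗ[ℂ] S) :
    TensorProduct.map f (g - h) = TensorProduct.map f g - TensorProduct.map f h := by
  rw [eq_sub_iff_add_eq, ← TensorProduct.map_add_right, sub_add_cancel]

theorem map_sub_left' {P Q R S : Type*} [AddCommGroup P] [Module ℂ P] [AddCommGroup Q]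
    [Module ℂ Q] [AddCommGroup R] [Module ℂ R] [AddCommGroup S] [Module ℂ S]
    (f g : P →ₗ[ℂ] Q) (h : R →ₗ[ℂ] S) :
    TensorProduct.map (f - g) h = TensorProduct.map f h - TensorProduct.map g h := by
  rw [eq_sub_iff_add_eq, ← TensorProduct.map_add_left, sub_add_cancel]

open Bicomod DualTwoCocycle in
theorem ract_hom (Γ : BicovariantCalculus H E) :
    IsHom (Γ.bicomod.tensor (self A)) Γ.bicomod H.mul Γ.ract := by
  have hs : Function.Surjective (TensorProduct.map Γ.adb (LinearMap.id (M := A))) :=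
    TensorProduct.map_surjective Γ.adb_surjective Function.surjective_id
  have H₁ := Γ.isHom_adb.tensor (self A).isHom_id
  have K1 := Γ.isHom_adb.comp (((self A).isHom_id.tensor H.isHom_mul).comp
    (isHom_assoc (self A) (self A) (self A)))
  have K2 := Γ.isHom_adb.comp (H.isHom_mul.tensor (self A).isHom_id)
  have e1 : Γ.ract ∘ₗ TensorProduct.map Γ.adb LinearMap.id =
      Γ.adb ∘ₗ TensorProduct.map LinearMap.id H.mul ∘ₗ
        (TensorProduct.assoc ℂ A A A).toLinearMap -
      Γ.adb ∘ₗ TensorProduct.map H.mul LinearMap.id := by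
    apply TensorProduct.ext_threefold
    intro x y z
    simp [adb, Γ.leibniz, Γ.lact_ract, TensorProduct.tmul_add, Γ.mul_lact]
  have e2 : H.mul ∘ₗ TensorProduct.map LinearMap.id H.mul ∘ₗ
      (TensorProduct.assoc ℂ A A A).toLinearMap =
      H.mul ∘ₗ TensorProduct.map H.mul LinearMap.id := by
    apply TensorProduct.ext_threefold
    intro x y z
    simp [H.mul_assoc]
  constructor
  · intro x
    obtain ⟨t, rfl⟩ := hs x
    have h1 := H₁.lco t
    have h2 := K1.lco t
    have h2' := K2.lco t
    have h3 := LinearMap.congr_fun e1 t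
    rw [e2] at h2
    rw [h1, map_map', e1, map_sub_right', LinearMap.sub_apply, ← h2, ← h2',
      ← map_sub]
    exact congrArg _ h3
  · intro x
    obtain ⟨t, rfl⟩ := hs x
    have h1 := H₁.rco t
    have h2 := K1.rco t
    have h2' := K2.rco t
    have h3 := LinearMap.congr_fun e1 t
    rw [e2] at h2
    rw [h1, map_map', e1, map_sub_left', LinearMap.sub_apply, ← h2, ← h2',
      ← map_sub]
    exact congrArg _ h3

/-- The bicovariant bimodule underlying a bicovariant calculus. -/
def toBicovariantBimodule (Γ : BicovariantCalculus H E) : BicovariantBimodule H E where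
  toAlgBimodule := Γ.toAlgBimodule
  toBicomod := Γ.bicomod
  lact_hom := Γ.lact_hom
  ract_hom := Γ.ract_hom

theorem isHom_d (Γ : BicovariantCalculus H E) :
    Bicomod.IsHom (Bicomod.self A) Γ.bicomod LinearMap.id Γ.d := by
  have e : ∀ a, Γ.d a = Γ.adb (H.one ⊗ₜ a) := fun a => by simp [adb, Γ.one_lact]
  constructor
  · intro a
    rw [e, Γ.isHom_adb.lco]
    simp only [Bicomod.self, Bicomod.tensor, LinearMap.comp_apply, TensorProduct.map_tmul,
      H.comul_one, LinearEquiv.coe_coe]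
    hopf_tensor_induction comul (R := ℂ) a with a₁ a₂
    simp [H.one_mul, ← e]
  · intro a
    rw [e, Γ.isHom_adb.rco]
    simp only [Bicomod.self, Bicomod.tensor, LinearMap.comp_apply, TensorProduct.map_tmul,
      H.comul_one, LinearEquiv.coe_coe]
    hopf_tensor_induction comul (R := ℂ) a with a₁ a₂
    simp [H.one_mul, ← e]

theorem conj_of_isHom_id {C X Y : Type*} [AddCommMonoid C] [Module ℂ C] [Coalgebra ℂ C]
    [AddCommMonoid X] [Module ℂ X] [AddCommMonoid Y] [Module ℂ Y] {M : Bicomod C X}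
    {N : Bicomod C Y} {p : C →ₗ[ℂ] C} {h : X →ₗ[ℂ] Y} (hp : p = LinearMap.id)
    (H : Bicomod.IsHom M N p h) (u : (WithConv (C →ₗ[ℂ] ℂ))ˣ) (x : X) :
    N.conj u (h x) = h (M.conj u x) := by
  subst hp
  simp only [Bicomod.conj, LinearMap.comp_apply, H.actL, H.actR, LinearMap.comp_id]

theorem leibnizΩ (Γ : BicovariantCalculus H E) (c : DualTwoCocycle H) (a b : A) :
    Γ.d (c.mulΩ (a ⊗ₜ b)) = Γ.toBicovariantBimodule.ractΩ c (Γ.d a ⊗ₜ b) +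
      Γ.toBicovariantBimodule.lactΩ c (a ⊗ₜ Γ.d b) := by
  have e : ∀ t : A ⊗[ℂ] A, Γ.d (H.mul t) =
      Γ.ract (TensorProduct.map Γ.d LinearMap.id t) +
        Γ.lact (TensorProduct.map LinearMap.id Γ.d t) := by
    intro t
    induction t with
    | zero => simp
    | add s t hs ht => simp only [map_add, hs, ht]; abel
    | tmul x y => simp [Γ.leibniz]
  have h1 := conj_of_isHom_id TensorProduct.map_id
    (Γ.isHom_d.tensor (Bicomod.self A).isHom_id) c.Ω (a ⊗ₜ b)
  have h2 := conj_of_isHom_id TensorProduct.map_id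
    ((Bicomod.self A).isHom_id.tensor Γ.isHom_d) c.Ω (a ⊗ₜ b)
  exact (e _).trans (congrArg₂ (· + ·) (congrArg Γ.ract h1).symm (congrArg Γ.lact h2).symm)

theorem adbΩ_eq (Γ : BicovariantCalculus H E) (c : DualTwoCocycle H) :
    Γ.toBicovariantBimodule.lactΩ c ∘ₗ Γ.d.lTensor A =
      Γ.adb ∘ₗ ((Bicomod.self A).tensor (Bicomod.self A)).conj c.Ω :=
  LinearMap.ext fun t => congrArg Γ.lact (conj_of_isHom_id TensorProduct.map_id
    ((Bicomod.self A).isHom_id.tensor Γ.isHom_d) c.Ω t)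

theorem surjectiveΩ (Γ : BicovariantCalculus H E) (c : DualTwoCocycle H) :
    Function.Surjective (Γ.toBicovariantBimodule.lactΩ c ∘ₗ Γ.d.lTensor A) := by
  rw [adbΩ_eq]
  exact Γ.adb_surjective.comp
    (((Bicomod.self A).tensor (Bicomod.self A)).conjEquiv c.Ω).surjective

/-- A bicovariant bimodule with a bicovariant derivation `d` such that the elements `a d(b)` span
is a bicovariant calculus. -/
def ofBimodule (M : BicovariantBimodule H E) (d : A →ₗ[ℂ] E)
    (leibniz : ∀ a b, d (H.mul (a ⊗ₜ b)) = M.ract (d a ⊗ₜ b) + M.lact (a ⊗ₜ d b))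
    (surj : Function.Surjective (M.lact ∘ₗ d.lTensor A))
    (hd : Bicomod.IsHom (Bicomod.self A) M.toBicomod LinearMap.id d) :
    BicovariantCalculus H E where
  toAlgBimodule := M.toAlgBimodule
  d := d
  leibniz := leibniz
  exists_eq_sum ρ := by
    obtain ⟨t, rfl⟩ := surj ρ
    obtain ⟨K, a, b, rfl⟩ := exists_fin_sum t
    exact ⟨K, a, b, by simp⟩
  left_covariant K a b h := by
    have h1 : ∀ k, M.lco (M.lact (a k ⊗ₜ d (b k))) = _ := fun k => M.lact_hom.lco _
    have h2 := congrArg M.lco h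
    simp only [map_sum, map_zero, h1, Bicomod.tensor, LinearMap.comp_apply,
      TensorProduct.map_tmul, hd.lco] at h2
    exact h2
  right_covariant K a b h := by
    have h1 : ∀ k, M.rco (M.lact (a k ⊗ₜ d (b k))) = _ := fun k => M.lact_hom.rco _
    have h2 := congrArg M.rco h
    simp only [map_sum, map_zero, h1, Bicomod.tensor, LinearMap.comp_apply,
      TensorProduct.map_tmul, hd.rco] at h2
    exact h2

/-- The deformed bicovariant calculus `(E_Ω, d_Ω)` over `A_Ω`, where `d_Ω = d` as a linear map. -/
def deform (Γ : BicovariantCalculus H E) (c : DualTwoCocycle H) :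
    BicovariantCalculus (H.deform c) E :=
  ofBimodule (Γ.toBicovariantBimodule.deform c) Γ.d (Γ.leibnizΩ c) (Γ.surjectiveΩ c) Γ.isHom_d

/-- A (right) connection: `∇(ea) = ∇(e)a + e ⊗ da`. -/
def IsConnection (Γ : BicovariantCalculus H E) (nabla : E →ₗ[ℂ] Γ.TensorSq) : Prop :=
  ∀ (e : E) (a : A), nabla (Γ.ract (e ⊗ₜ a)) = Γ.rmulSq a (nabla e) + Γ.proj (e ⊗ₜ Γ.d a)

/-- A bicovariant connection: a connection that is a map of left and of right comodules
`E → E ⊗_A E`. -/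
structure IsBicovariantConnection (Γ : BicovariantCalculus H E) (nabla : E →ₗ[ℂ] Γ.TensorSq) :
    Prop where
  isConnection : Γ.IsConnection nabla
  left_covariant : ∀ e, nabla.lTensor A (Γ.toBicovariantBimodule.lco e) =
    Γ.toBicovariantBimodule.lcoSq (nabla e)
  right_covariant : ∀ e, nabla.rTensor A (Γ.toBicovariantBimodule.rco e) =
    Γ.toBicovariantBimodule.rcoSq (nabla e)

/-- The isomorphism `ξ : E_Ω ⊗_{A_Ω} E_Ω → (E ⊗_A E)_Ω` of a bicovariant calculus, where
`(E ⊗_A E)_Ω` is `E ⊗_A E` as a vector space. -/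
def xi (Γ : BicovariantCalculus H E) (c : DualTwoCocycle H) :
    (Γ.deform c).TensorSq ≃ₗ[ℂ] Γ.TensorSq :=
  Γ.toBicovariantBimodule.xi c

/-- The deformation `∇_Ω = ξ⁻¹ ∘ ∇ : E_Ω → E_Ω ⊗_{A_Ω} E_Ω` of a linear map `∇ : E → E ⊗_A E`. -/
def deformMap (Γ : BicovariantCalculus H E) (c : DualTwoCocycle H) (nabla : E →ₗ[ℂ] Γ.TensorSq) :
    E →ₗ[ℂ] (Γ.deform c).TensorSq :=
  (Γ.xi c).symm.toLinearMap ∘ₗ nabla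

end BicovariantCalculus
end

/-! Everything deformed here is the original operation composed with one kind of twist. For a
bicomodule `X` over a coalgebra `C` and a convolution-invertible functional `u` on `C`, the twist
`conj u` sends `x` to `u(x₍₋₁₎) x₍₀₎ u⁻¹(x₍₁₎)`; it is invertible, and it commutes with every map of
bicomodules along the identity of `C`. The deformed product and actions are the old ones after the
twist by `Ω` on a tensor product over `ℂ`, a bicomodule over `A ⊗ A`, and `ξ` is the same twist
passed to the balanced quotients.

Write the Leibniz rule as an identity in `t : E ⊗ A`, namely `∇(ract t) = ractSq((∇ ⊗ id) t) +
proj((id ⊗ d) t)`. Let `u` be the twist on `E ⊗ A`, and apply `ξ` to the deformed rule for `∇_Ω =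
ξ⁻¹ ∘ ∇`. The left side becomes `∇(ract (u t))` by definition. In the action term, the cocycle
identity (`xi_ractSq`) turns the deformed action into the old action after a twist, and the twist
passes through `∇ ⊗ id` because `∇` is bicolinear. In the last term it passes through `id ⊗ d`
because `d` is bicolinear. So the deformed rule at `t` is the original rule at `u t`, and `u` is
bijective: this is `isConnection_deformMap_iff`.

Bicolinearity itself transfers because `ξ` is an isomorphism of bicomodules over the common
coalgebra of `A` and `A_Ω` (`isHom_xi`). Hence `∇_Ω` is a bicovariant connection if and only if `∇`
is. Since composition with `ξ⁻¹` is already a bijection on linear maps, the equivalence gives both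
claims. -/

noncomputable section

/-! ### The balanced tensor square as a bicomodule, and bicolinearity of `ξ`. -/

namespace BicovariantBimodule

variable {A E : Type*} [AddCommGroup A] [Module ℂ A] [Coalgebra ℂ A] {H : BialgStr A}
  [AddCommGroup E] [Module ℂ E]

/-- The balanced tensor square `E ⊗_A E` as a bicomodule. -/
def bicomodSq (M : BicovariantBimodule H E) : Bicomod A M.TensorSq :=
  Bicomod.ofSurjective (M.toBicomod.tensor M.toBicomod) H.mulHom M.proj
    (Submodule.mkQ_surjective _) M.lcoSq M.rcoSq (fun _ => rfl) (fun _ => rfl)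

theorem isHom_proj (M : BicovariantBimodule H E) :
    Bicomod.IsHom (M.toBicomod.tensor M.toBicomod) M.bicomodSq H.mul M.proj :=
  ⟨fun _ => rfl, fun _ => rfl⟩

/-- `ξ` intertwines the coactions on the deformed and the original balanced tensor square. -/
theorem isHom_xi (M : BicovariantBimodule H E) (c : DualTwoCocycle H) :
    Bicomod.IsHom (M.deform c).bicomodSq M.bicomodSq LinearMap.id (M.xi c).toLinearMap := by
  -- The twist on `E ⊗ E` is a bicomodule map along the twist of `A ⊗ A`, so `proj` after the twist
  -- is one along `H.mul` after the twist. The latter is the product of `A_Ω`, which defines the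
  -- coactions on the deformed square. Since `ξ` is the factorization of this composite through the
  -- deformed quotient, only the identity of `A` remains below it.
  have h := M.isHom_proj.comp ((M.toBicomod.tensor M.toBicomod).conj_isHom c.Ω)
  constructor
  · intro s
    obtain ⟨t, rfl⟩ := Submodule.mkQ_surjective _ s
    refine (h.lco t).trans ?_
    rw [(M.deform c).isHom_proj.lco, Bicomod.map_map']
    rfl
  · intro s
    obtain ⟨t, rfl⟩ := Submodule.mkQ_surjective _ s
    refine (h.rco t).trans ?_
    rw [(M.deform c).isHom_proj.rco, Bicomod.map_map']
    rfl

end BicovariantBimodule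

/-! ### The right action on the balanced square and its compatibility with `ξ`. -/

namespace AlgBimodule

variable {A E : Type*} [AddCommGroup A] [Module ℂ A] [Coalgebra ℂ A] {H : BialgStr A}
  [AddCommGroup E] [Module ℂ E]

theorem rmulSq_proj (M : AlgBimodule H E) (a : A) (m n : E) :
    M.rmulSq a (M.proj (m ⊗ₜ n)) = M.proj (m ⊗ₜ M.ract (n ⊗ₜ a)) :=
  rfl

/-- The right action `E ⊗_A E ⊗ A → E ⊗_A E` as a linear map. -/
def ractSq (M : AlgBimodule H E) : M.TensorSq ⊗[ℂ] A →ₗ[ℂ] M.TensorSq :=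
  TensorProduct.lift (LinearMap.flip
    { toFun := M.rmulSq
      map_add' := fun a b => by
        ext m n
        simp [rmulSq, rmul, TensorProduct.tmul_add]
      map_smul' := fun r a => by
        ext m n
        simp [rmulSq, rmul] })

end AlgBimodule

namespace BicovariantBimodule

variable {A E : Type*} [AddCommGroup A] [Module ℂ A] [Coalgebra ℂ A] {H : BialgStr A}
  [AddCommGroup E] [Module ℂ E]

/-- `ξ` intertwines the right action of `A_Ω` on `E_Ω ⊗_{A_Ω} E_Ω` with the deformed right action
on `E ⊗_A E`. -/
theorem xi_ractSq (M : BicovariantBimodule H E) (c : DualTwoCocycle H)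
    (t : (M.deform c).TensorSq ⊗[ℂ] A) :
    M.xi c ((M.deform c).ractSq t) =
      M.ractSq ((M.bicomodSq.tensor (Bicomod.self A)).conj c.Ω
        (TensorProduct.map (M.xi c).toLinearMap LinearMap.id t)) := by
  induction t with
  | zero => simp
  | add s t hs ht => simp only [map_add, hs, ht]
  | tmul s a =>
    obtain ⟨s, rfl⟩ := Submodule.mkQ_surjective _ s
    induction s with
    | zero => simp
    | add s t hs ht => simp only [map_add, TensorProduct.add_tmul, hs, ht]
    | tmul m n =>
      -- The identity `(m ⊗ n)a = m ⊗ na` is an associativity law for `proj`, `ract` and `ractSq`,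
      -- so the cocycle condition carries it over to the twisted operations. One bracketing is the
      -- deformed action on the image of `ξ`; the other is `ξ` of the action in `E_Ω ⊗_{A_Ω} E_Ω`.
      exact (c.deformed_assoc M.isHom_proj M.ract_hom M.ractSq M.proj
        (fun x y z => M.rmulSq_proj z x y) m n a).symm

end BicovariantBimodule

/-! ### The coactions of the deformed calculus. -/

namespace BicovariantCalculus

variable {A E : Type*} [AddCommGroup A] [Module ℂ A] [Coalgebra ℂ A] {H : BialgStr A}
  [AddCommGroup E] [Module ℂ E]

/-- The elements `a d(b)` span `E`, and bicolinearity of `d` and of the left action forces the value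
of any coaction on them. The coactions reconstructed from the calculus therefore agree with the
given ones, though not by definition. -/
theorem bicomod_ofBimodule (M : BicovariantBimodule H E) (d : A →ₗ[ℂ] E)
    (leibniz : ∀ a b, d (H.mul (a ⊗ₜ b)) = M.ract (d a ⊗ₜ b) + M.lact (a ⊗ₜ d b))
    (surj : Function.Surjective (M.lact ∘ₗ d.lTensor A))
    (hd : Bicomod.IsHom (Bicomod.self A) M.toBicomod LinearMap.id d) :
    (ofBimodule M d leibniz surj hd).bicomod = M.toBicomod := by
  have h := M.lact_hom.comp ((Bicomod.self A).isHom_id.tensor hd)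
  have k := (ofBimodule M d leibniz surj hd).isHom_adb
  rw [TensorProduct.map_id, LinearMap.comp_id] at h
  have hl : (ofBimodule M d leibniz surj hd).bicomod.lco = M.lco := by
    ext e
    obtain ⟨t, rfl⟩ := surj e
    exact (k.lco t).trans (h.lco t).symm
  have hr : (ofBimodule M d leibniz surj hd).bicomod.rco = M.rco := by
    ext e
    obtain ⟨t, rfl⟩ := surj e
    exact (k.rco t).trans (h.rco t).symm
  -- Apart from its two coactions, a `Bicomod` contains only propositions, so `hl` and `hr` suffice.
  generalize (ofBimodule M d leibniz surj hd).bicomod = N at hl hr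
  obtain ⟨⟩ := N
  generalize M.toBicomod = N at hl hr
  obtain ⟨⟩ := N
  congr

theorem bicomod_deform (Γ : BicovariantCalculus H E) (c : DualTwoCocycle H) :
    (Γ.deform c).bicomod = Γ.bicomod :=
  bicomod_ofBimodule _ _ _ _ _

/-- The two bicovariant bimodules share their actions, hence definitionally the same balanced
square. Only the coactions on the factors come from different constructions, and `bicomod_deform`
identifies those. -/
theorem lcoSq_deform (Γ : BicovariantCalculus H E) (c : DualTwoCocycle H)
    (s : (Γ.deform c).TensorSq) :
    (Γ.deform c).toBicovariantBimodule.lcoSq s = (Γ.toBicovariantBimodule.deform c).lcoSq s := by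
  obtain ⟨t, rfl⟩ := Submodule.mkQ_surjective _ s
  exact congrArg (fun N : Bicomod A E =>
    TensorProduct.map (H.deform c).mul (Γ.deform c).proj ((N.tensor N).lco t)) (Γ.bicomod_deform c)

theorem rcoSq_deform (Γ : BicovariantCalculus H E) (c : DualTwoCocycle H)
    (s : (Γ.deform c).TensorSq) :
    (Γ.deform c).toBicovariantBimodule.rcoSq s = (Γ.toBicovariantBimodule.deform c).rcoSq s := by
  obtain ⟨t, rfl⟩ := Submodule.mkQ_surjective _ s
  exact congrArg (fun N : Bicomod A E =>
    TensorProduct.map (Γ.deform c).proj (H.deform c).mul ((N.tensor N).rco t)) (Γ.bicomod_deform c)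

/-! ### Connections in terms of arbitrary tensors and bicomodule maps. -/

/-- All three terms are linear in `e ⊗ a`. General tensors are needed because the twist of a pure
tensor is usually not pure. -/
theorem isConnection_iff (Γ : BicovariantCalculus H E) (nabla : E →ₗ[ℂ] Γ.TensorSq) :
    Γ.IsConnection nabla ↔ ∀ t : E ⊗[ℂ] A, nabla (Γ.ract t) =
      Γ.ractSq (TensorProduct.map nabla LinearMap.id t) +
        Γ.proj (TensorProduct.map LinearMap.id Γ.d t) := by
  refine ⟨fun h t => ?_, fun h e a => h (e ⊗ₜ a)⟩
  induction t with
  | zero => simp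
  | add s t hs ht => simp only [map_add, hs, ht]; abel
  | tmul e a => exact h e a

/-- Packaging both covariance conditions as one bicomodule map makes naturality of the twist
applicable to `nabla`. -/
theorem isBicovariantConnection_iff (Γ : BicovariantCalculus H E) (nabla : E →ₗ[ℂ] Γ.TensorSq) :
    Γ.IsBicovariantConnection nabla ↔ Γ.IsConnection nabla ∧
      Bicomod.IsHom Γ.bicomod Γ.toBicovariantBimodule.bicomodSq LinearMap.id nabla :=
  ⟨fun h => ⟨h.1, fun e => (h.2 e).symm, fun e => (h.3 e).symm⟩,
    fun h => ⟨h.1, fun e => (h.2.lco e).symm, fun e => (h.2.rco e).symm⟩⟩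

/-- This replaces the coactions reconstructed from the deformed calculus by those of `E` itself, so
that covariance of a map and of its deformation refer to the same source bicomodule. -/
theorem isBicovariantConnection_deform_iff (Γ : BicovariantCalculus H E) (c : DualTwoCocycle H)
    (nabla : E →ₗ[ℂ] (Γ.deform c).TensorSq) :
    (Γ.deform c).IsBicovariantConnection nabla ↔ (Γ.deform c).IsConnection nabla ∧
      Bicomod.IsHom Γ.bicomod (Γ.toBicovariantBimodule.deform c).bicomodSq LinearMap.id nabla := by
  have hl : ∀ e, (Γ.deform c).toBicovariantBimodule.lco e = Γ.bicomod.lco e := fun e =>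
    congrArg (fun N : Bicomod A E => N.lco e) (Γ.bicomod_deform c)
  have hr : ∀ e, (Γ.deform c).toBicovariantBimodule.rco e = Γ.bicomod.rco e := fun e =>
    congrArg (fun N : Bicomod A E => N.rco e) (Γ.bicomod_deform c)
  constructor
  · rintro ⟨h, h1, h2⟩
    refine ⟨h, fun e => ?_, fun e => ?_⟩
    · have := h1 e
      rw [hl, lcoSq_deform] at this
      exact this.symm
    · have := h2 e
      rw [hr, rcoSq_deform] at this
      exact this.symm
  · rintro ⟨h, h1, h2⟩
    refine ⟨h, fun e => ?_, fun e => ?_⟩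
    · rw [hl, lcoSq_deform]
      exact (h1 e).symm
    · rw [hr, rcoSq_deform]
      exact (h2 e).symm

/-! ### Transfer of covariance and of the Leibniz rule through `ξ`. -/

theorem isHom_xi_symm (Γ : BicovariantCalculus H E) (c : DualTwoCocycle H) :
    Bicomod.IsHom Γ.toBicovariantBimodule.bicomodSq
      (Γ.toBicovariantBimodule.deform c).bicomodSq LinearMap.id
      (Γ.toBicovariantBimodule.xi c).symm.toLinearMap := by
  have h := Γ.toBicovariantBimodule.isHom_xi c
  have e : (Γ.toBicovariantBimodule.xi c).symm.toLinearMap ∘ₗ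
      (Γ.toBicovariantBimodule.xi c).toLinearMap = LinearMap.id := by
    ext s; simp
  constructor
  · intro s
    obtain ⟨t, rfl⟩ := (Γ.toBicovariantBimodule.xi c).surjective s
    have := h.lco t
    rw [LinearEquiv.coe_coe] at this
    rw [this, Bicomod.map_map', e]
    simp
  · intro s
    obtain ⟨t, rfl⟩ := (Γ.toBicovariantBimodule.xi c).surjective s
    have := h.rco t
    rw [LinearEquiv.coe_coe] at this
    rw [this, Bicomod.map_map', e]
    simp

/-- Composing with `ξ⁻¹` or with `ξ` preserves bicolinearity. The Leibniz rule plays no role, so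
this can be settled first and then used as the hypothesis of `isConnection_deformMap_iff`. -/
theorem isHom_deformMap_iff (Γ : BicovariantCalculus H E) (c : DualTwoCocycle H)
    (nabla : E →ₗ[ℂ] Γ.TensorSq) :
    Bicomod.IsHom Γ.bicomod (Γ.toBicovariantBimodule.deform c).bicomodSq LinearMap.id
        (Γ.deformMap c nabla) ↔
      Bicomod.IsHom Γ.bicomod Γ.toBicovariantBimodule.bicomodSq LinearMap.id nabla := by
  refine ⟨fun h => ?_, fun h => (Γ.isHom_xi_symm c).comp h⟩
  have k := (Γ.toBicovariantBimodule.isHom_xi c).comp h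
  rw [LinearMap.comp_id] at k
  have e : (Γ.toBicovariantBimodule.xi c).toLinearMap ∘ₗ Γ.deformMap c nabla = nabla :=
    LinearMap.ext fun e => (Γ.xi c).apply_symm_apply (nabla e)
  exact e ▸ k

/-- For bicovariant maps, the Leibniz rule of the deformed map at `t` is the original one at
the twist of `t`. -/
theorem isConnection_deformMap_iff (Γ : BicovariantCalculus H E) (c : DualTwoCocycle H)
    (nabla : E →ₗ[ℂ] Γ.TensorSq)
    (h : Bicomod.IsHom Γ.bicomod Γ.toBicovariantBimodule.bicomodSq LinearMap.id nabla) :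
    (Γ.deform c).IsConnection (Γ.deformMap c nabla) ↔ Γ.IsConnection nabla := by
  set u := (Γ.bicomod.tensor (Bicomod.self A)).conjEquiv c.Ω
  have key : ∀ t : E ⊗[ℂ] A,
      Γ.deformMap c nabla ((Γ.deform c).ract t) =
          (Γ.deform c).ractSq (TensorProduct.map (Γ.deformMap c nabla) LinearMap.id t) +
            (Γ.deform c).proj (TensorProduct.map LinearMap.id (Γ.deform c).d t) ↔
        nabla (Γ.ract (u t)) = Γ.ractSq (TensorProduct.map nabla LinearMap.id (u t)) +
          Γ.proj (TensorProduct.map LinearMap.id Γ.d (u t)) := by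
    intro t
    rw [← (Γ.xi c).injective.eq_iff, map_add]
    -- The deformed right action is by definition the original one after `u`, and `ξ` cancels `ξ⁻¹`.
    have e0 : Γ.xi c (Γ.deformMap c nabla ((Γ.deform c).ract t)) = nabla (Γ.ract (u t)) :=
      (Γ.xi c).apply_symm_apply _
    have e1 : Γ.xi c ((Γ.deform c).ractSq
        (TensorProduct.map (Γ.deformMap c nabla) LinearMap.id t)) =
          Γ.ractSq (TensorProduct.map nabla LinearMap.id (u t)) := by
      refine (Γ.toBicovariantBimodule.xi_ractSq c _).trans (congrArg Γ.ractSq ?_)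
      -- The only use of `h`: bicolinearity of `nabla` lets the twist move from `(E ⊗_A E) ⊗ A`
      -- through `nabla ⊗ id` to `E ⊗ A`.
      refine Eq.trans ?_ (conj_of_isHom_id TensorProduct.map_id
        (h.tensor (Bicomod.self A).isHom_id) c.Ω t)
      refine congrArg _ ((Bicomod.map_map' _ _ _ _ t).trans ?_)
      congr 2
      ext e
      exact (Γ.xi c).apply_symm_apply (nabla e)
    -- Lifted to `E ⊗ E`, `ξ` is the twist, and it moves through `id ⊗ d` because `d` is bicolinear.
    have e2 : Γ.xi c ((Γ.deform c).proj (TensorProduct.map LinearMap.id (Γ.deform c).d t)) =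
        Γ.proj (TensorProduct.map LinearMap.id Γ.d (u t)) :=
      congrArg Γ.proj (conj_of_isHom_id TensorProduct.map_id
        (Γ.bicomod.isHom_id.tensor Γ.isHom_d) c.Ω t)
    rw [e0, e1, e2]
  rw [isConnection_iff, isConnection_iff]
  simp only [key]
  -- Since `u` is onto, the rule at all `u t` is the rule at all tensors.
  exact ⟨fun h t => u.apply_symm_apply t ▸ h (u.symm t), fun h t => h (u t)⟩

theorem isBicovariantConnection_deformMap_iff (Γ : BicovariantCalculus H E)
    (c : DualTwoCocycle H) (nabla : E →ₗ[ℂ] Γ.TensorSq) :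
    (Γ.deform c).IsBicovariantConnection (Γ.deformMap c nabla) ↔
      Γ.IsBicovariantConnection nabla := by
  rw [isBicovariantConnection_deform_iff, isHom_deformMap_iff, isBicovariantConnection_iff]
  -- The Leibniz rules need only be compared when `nabla` is bicolinear, which is what
  -- `and_congr_left` allows.
  exact and_congr_left (Γ.isConnection_deformMap_iff c nabla)

end BicovariantCalculus

end

/-! ### The bijection between bicovariant connections. -/

theorem mainTheorem10 {A E : Type*} [Ring A] [HopfAlgebra ℂ A] [AddCommGroup E] [Module ℂ E]
    (Γ : BicovariantCalculus (BialgStr.of A) E) (Ω : DualTwoCocycle (BialgStr.of A)) :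
    (∀ nabla : E →ₗ[ℂ] Γ.TensorSq, Γ.IsBicovariantConnection nabla →
      (Γ.deform Ω).IsBicovariantConnection (Γ.deformMap Ω nabla)) ∧
    Set.BijOn (Γ.deformMap Ω) {nabla | Γ.IsBicovariantConnection nabla}
      {nabla' | (Γ.deform Ω).IsBicovariantConnection nabla'} := by
  have key := Γ.isBicovariantConnection_deformMap_iff Ω
  refine ⟨fun nabla => (key nabla).2, fun nabla => (key nabla).2, ?_, ?_⟩
  · intro f _ g _ h
    ext e
    exact (Γ.xi Ω).symm.injective (LinearMap.congr_fun h e)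
  · intro f hf
    -- The preimage of `f` can only be `ξ ∘ f`; the converse half of `key` makes it a bicovariant
    -- connection.
    have e : Γ.deformMap Ω ((Γ.xi Ω).toLinearMap ∘ₗ f) = f := by
      ext e
      exact (Γ.xi Ω).symm_apply_apply (f e)
    exact ⟨_, (key _).1 (by rw [e]; exact hf), e⟩
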